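/- A \emph{hyperbolic polygon} is a compact region of the hyperbolic plane $\mathbb{H}^2$ enclosed by a simple closed curve consisting of finitely many geodesic segments (its sides, whose endpoints are its vertices). A \emph{polygonal tiling} of $\mathbb{H}^2$ is a family of hyperbolic polygons (tiles) that covers $\mathbb{H}^2$, such that the tiles have pairwise disjoint interiors, any two different tiles are either disjoint or intersect exactly in a union of some common sides and common vertices, and every vertex is an endpoint of only finitely many sides (i.e. the graph formed by all vertices and sides of the tiles is locally finite). Let $\mathcal{T}$ be a polygonal tiling of $\mathbb{H}^2$, let $\Gamma$ be a group of isometries of $\mathbb{H}^2$ which preserves $\mathcal{T}$ and acts transitively on the set of vertices of $\mathcal{T}$, and let $\Gamma_{\mathrm{F}}\le\Gamma$ be the subgroup of all orientation preserving isometries in $\Gamma$. Then for any two closed halfplanes $H_1,H_2\subset\mathbb{H}^2$ (a closed halfplane being a closed side of a geodesic line) there exists $\gamma\in\Gamma_{\mathrm{F}}$ with $\gamma(H_1)\subseteq H_2$. -/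

import Mathlib

open UpperHalfPlane

namespace HypTiling

/-- The geodesic segment joining two points of the hyperbolic plane. -/
def geodSegment (x y : ℍ) : Set ℍ := {z | dist x z + dist z y = dist x y}

theorem image_geodSegment (g : ℍ ≃ᵢ ℍ) (x y : ℍ) :
    g '' geodSegment x y = geodSegment (g x) (g y) := by
  ext z
  constructor
  · rintro ⟨w, hw, rfl⟩
    simpa [geodSegment, g.dist_eq] using hw
  · intro hz
    refine ⟨g.symm z, ?_, by simp⟩
    have h1 : dist x (g.symm z) = dist (g x) z := by
      rw [← g.dist_eq, g.apply_symm_apply]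
    have h2 : dist (g.symm z) y = dist z (g y) := by
      rw [← g.dist_eq, g.apply_symm_apply]
    have hz' : dist (g x) z + dist z (g y) = dist (g x) (g y) := hz
    change dist x (g.symm z) + dist (g.symm z) y = dist x y
    rw [h1, h2, hz', g.dist_eq]

/-- The geodesic segments joining cyclically consecutive points of `v` form a simple closed
curve. A straight angle at a point `v i` is allowed. -/
structure IsSimpleClosed {n : ℕ} (v : ZMod n → ℍ) : Prop where
  injective : Function.Injective v
  consecutive : ∀ i, geodSegment (v i) (v (i + 1)) ∩ geodSegment (v (i + 1)) (v (i + 1 + 1))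
    = {v (i + 1)}
  nonconsecutive : ∀ i j, j ≠ i → j ≠ i + 1 → i ≠ j + 1 →
    Disjoint (geodSegment (v i) (v (i + 1))) (geodSegment (v j) (v (j + 1)))

/-- A (finite sided, compact, not necessarily convex) hyperbolic polygon: the compact region
enclosed by a simple closed curve made of `n ≥ 3` geodesic segments, together with the data of its
vertices and sides. -/
structure Polygon where
  carrier : Set ℍ
  vertices : Set ℍ
  sides : Set (Set ℍ)
  isCompact : IsCompact carrier
  closure_interior : closure (interior carrier) = carrier
  boundary : ∃ (n : ℕ) (v : ZMod n → ℍ), 3 ≤ n ∧ IsSimpleClosed v ∧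
    vertices = Set.range v ∧
    sides = Set.range (fun i => geodSegment (v i) (v (i + 1))) ∧
    frontier carrier = ⋃ i, geodSegment (v i) (v (i + 1))

/-- The image of a polygon under an isometry of the hyperbolic plane. -/
def Polygon.map (g : ℍ ≃ᵢ ℍ) (P : Polygon) : Polygon where
  carrier := g '' P.carrier
  vertices := g '' P.vertices
  sides := (fun s => g '' s) '' P.sides
  isCompact := P.isCompact.image g.continuous
  closure_interior := by
    have h := congrArg (fun s => g.toHomeomorph '' s) P.closure_interior
    simp only [Homeomorph.image_closure, Homeomorph.image_interior] at h
    exact h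
  boundary := by
    obtain ⟨n, v, hn, hv, hV, hS, hF⟩ := P.boundary
    refine ⟨n, fun i => g (v i), hn, ⟨g.injective.comp hv.injective, fun i => ?_,
      fun i j h1 h2 h3 => ?_⟩, ?_, ?_, ?_⟩
    · rw [← image_geodSegment, ← image_geodSegment, ← Set.image_inter g.injective,
        hv.consecutive, Set.image_singleton]
    · rw [← image_geodSegment, ← image_geodSegment]
      exact (Set.disjoint_image_iff g.injective).2 (hv.nonconsecutive i j h1 h2 h3)
    · rw [hV, ← Set.range_comp]
      rfl
    · rw [hS, ← Set.range_comp]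
      exact congrArg Set.range (funext fun i => image_geodSegment g _ _)
    · have h := congrArg (fun s => g.toHomeomorph '' s) hF
      simp only [Homeomorph.image_frontier, Set.image_iUnion] at h
      refine Eq.trans h (Set.iUnion_congr fun i => image_geodSegment g _ _)

/-- The vertices of the graph of a family of polygons. -/
def tilingVertices (𝒯 : Set Polygon) : Set ℍ := ⋃ T ∈ 𝒯, T.vertices

/-- The edges of the graph of a family of polygons, as geodesic segments. -/
def tilingEdges (𝒯 : Set Polygon) : Set (Set ℍ) := ⋃ T ∈ 𝒯, T.sides

/-- A polygonal tiling of the hyperbolic plane with locally finite graph. -/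
structure IsTiling (𝒯 : Set Polygon) : Prop where
  covers : ⋃ T ∈ 𝒯, T.carrier = Set.univ
  disjoint_interior : ∀ T ∈ 𝒯, ∀ T' ∈ 𝒯, T ≠ T' → Disjoint (interior T.carrier) (interior T'.carrier)
  /-- Two different tiles meet in a (possibly empty) union of common sides and vertices. -/
  inter_eq : ∀ T ∈ 𝒯, ∀ T' ∈ 𝒯, T ≠ T' →
    ∃ S ⊆ T.sides ∩ T'.sides, ∃ W ⊆ T.vertices ∩ T'.vertices,
      T.carrier ∩ T'.carrier = ⋃₀ S ∪ W
  /-- Every vertex of the graph has finite degree. -/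
  finite_degree : ∀ x ∈ tilingVertices 𝒯, {e ∈ tilingEdges 𝒯 | x ∈ e}.Finite

/-- `Γ` preserves the tiling `𝒯` and acts transitively on its vertices. -/
structure ActsVertexTransitively (Γ : Subgroup (ℍ ≃ᵢ ℍ)) (𝒯 : Set Polygon) : Prop where
  preserves : ∀ g ∈ Γ, ∀ T ∈ 𝒯, T.map g ∈ 𝒯
  transitive : ∀ x ∈ tilingVertices 𝒯, ∀ y ∈ tilingVertices 𝒯, ∃ g ∈ Γ, g x = y

/-- A self-map of the upper half-plane, read as a map between subsets of `ℂ`. -/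
noncomputable def inCoord (g : ℍ → ℍ) : ℂ → ℂ := fun w => (g (ofComplex w) : ℂ)

/-- An isometry preserves orientation if the determinant of its real differential is positive at
every point (in particular the differential exists: the junk value of `fderiv` has
determinant zero). -/
def OrientationPreserving (g : ℍ ≃ᵢ ℍ) : Prop :=
  ∀ z : ℍ, 0 < (fderiv ℝ (inCoord g) (z : ℂ)).det

theorem det_zero_clm : (0 : ℂ →L[ℝ] ℂ).det = 0 := by
  have h : (0 : ℂ →ₗ[ℝ] ℂ).det = 0 := by
    rw [LinearMap.det_zero]
    simp
  exact h

theorem OrientationPreserving.differentiableAt {g : ℍ ≃ᵢ ℍ} (hg : OrientationPreserving g)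
    (z : ℍ) : DifferentiableAt ℝ (inCoord g) (z : ℂ) := by
  by_contra h
  have := hg z
  rw [fderiv_zero_of_not_differentiableAt h, det_zero_clm] at this
  exact lt_irrefl _ this

theorem inCoord_coe (g : ℍ → ℍ) (z : ℍ) : inCoord g z = g z := by
  simp [inCoord]

theorem inCoord_comp (g h : ℍ → ℍ) : inCoord (g ∘ h) = inCoord g ∘ inCoord h := by
  funext w
  simp [inCoord]

theorem inCoord_id_eventuallyEq (z : ℍ) : inCoord id =ᶠ[nhds (z : ℂ)] id := by
  filter_upwards [isOpen_upperHalfPlaneSet.mem_nhds z.im_pos] with w hw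
  simp [inCoord, ofComplex_apply_of_im_pos hw]

theorem fderiv_inCoord_id (z : ℍ) :
    fderiv ℝ (inCoord id) (z : ℂ) = ContinuousLinearMap.id ℝ ℂ := by
  rw [(inCoord_id_eventuallyEq z).fderiv_eq, fderiv_id]

theorem det_comp_clm (A B : ℂ →L[ℝ] ℂ) : (A.comp B).det = A.det * B.det :=
  LinearMap.det_comp (A : ℂ →ₗ[ℝ] ℂ) (B : ℂ →ₗ[ℝ] ℂ)

theorem det_id_clm : (ContinuousLinearMap.id ℝ ℂ).det = 1 :=
  LinearMap.det_id

theorem OrientationPreserving.one : OrientationPreserving 1 := by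
  intro z
  change 0 < (fderiv ℝ (inCoord id) (z : ℂ)).det
  rw [fderiv_inCoord_id, det_id_clm]
  exact one_pos

theorem OrientationPreserving.mul {g h : ℍ ≃ᵢ ℍ} (hg : OrientationPreserving g)
    (hh : OrientationPreserving h) : OrientationPreserving (g * h) := by
  intro z
  change 0 < (fderiv ℝ (inCoord (g ∘ h)) (z : ℂ)).det
  have e : inCoord h (z : ℂ) = ((h z : ℍ) : ℂ) := inCoord_coe h z
  rw [inCoord_comp, fderiv_comp (z : ℂ) (e ▸ hg.differentiableAt (h z)) (hh.differentiableAt z),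
    e, det_comp_clm]
  exact mul_pos (hg _) (hh _)

theorem continuousAt_inCoord (g : ℍ ≃ᵢ ℍ) (z : ℍ) : ContinuousAt (inCoord g) (z : ℂ) := by
  have h1 : ContinuousAt (fun w : ℂ => ofComplex w) (z : ℂ) :=
    (contMDiffAt_ofComplex (n := 0) z.im_pos).continuousAt
  exact (continuous_coe.comp g.continuous).continuousAt.comp h1

theorem OrientationPreserving.inv {g : ℍ ≃ᵢ ℍ} (hg : OrientationPreserving g) :
    OrientationPreserving g⁻¹ := by
  intro z
  have e : inCoord (g⁻¹ : ℍ ≃ᵢ ℍ) (z : ℂ) = ((g⁻¹ z : ℍ) : ℂ) := inCoord_coe _ z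
  have hd := hg (g⁻¹ z)
  have hD := (hg.differentiableAt (g⁻¹ z)).hasFDerivAt
  set A := fderiv ℝ (inCoord g) ((g⁻¹ z : ℍ) : ℂ) with hA
  have hne : A.det ≠ 0 := hd.ne'
  have hcoe : ((A.toContinuousLinearEquivOfDetNeZero hne : ℂ ≃L[ℝ] ℂ) : ℂ →L[ℝ] ℂ) = A := by
    ext <;> simp
  have hD' : HasFDerivAt (inCoord g)
      ((A.toContinuousLinearEquivOfDetNeZero hne : ℂ ≃L[ℝ] ℂ) : ℂ →L[ℝ] ℂ)
      (inCoord (g⁻¹ : ℍ ≃ᵢ ℍ) (z : ℂ)) := by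
    rw [hcoe, e]
    exact hD
  have hcomp : (g : ℍ → ℍ) ∘ (g⁻¹ : ℍ ≃ᵢ ℍ) = id := by
    funext w
    exact g.apply_symm_apply w
  have hinv : ∀ᶠ w in nhds (z : ℂ), inCoord g (inCoord (g⁻¹ : ℍ ≃ᵢ ℍ) w) = w := by
    filter_upwards [inCoord_id_eventuallyEq z] with w hw
    have := congrFun (inCoord_comp g (g⁻¹ : ℍ ≃ᵢ ℍ)) w
    rw [hcomp, hw] at this
    exact this.symm
  have hB := HasFDerivAt.of_local_left_inverse (continuousAt_inCoord g⁻¹ z) hD' hinv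
  have hprod : fderiv ℝ (inCoord (g ∘ (g⁻¹ : ℍ ≃ᵢ ℍ))) (z : ℂ)
      = A.comp (fderiv ℝ (inCoord (g⁻¹ : ℍ ≃ᵢ ℍ)) (z : ℂ)) := by
    rw [inCoord_comp, fderiv_comp (z : ℂ) hD'.differentiableAt hB.differentiableAt, e]
  rw [hcomp, fderiv_inCoord_id] at hprod
  have hdet := congrArg ContinuousLinearMap.det hprod
  rw [det_id_clm, det_comp_clm] at hdet
  by_contra hneg
  have := mul_nonpos_of_nonneg_of_nonpos hd.le (not_lt.1 hneg)
  linarith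

/-- The subgroup of all orientation preserving isometries in `Γ`. -/
def orientationPreservingSubgroup (Γ : Subgroup (ℍ ≃ᵢ ℍ)) : Subgroup (ℍ ≃ᵢ ℍ) where
  carrier := {g | g ∈ Γ ∧ OrientationPreserving g}
  mul_mem' := fun ha hb => ⟨Γ.mul_mem ha.1 hb.1, ha.2.mul hb.2⟩
  one_mem' := ⟨Γ.one_mem, OrientationPreserving.one⟩
  inv_mem' := fun ha => ⟨Γ.inv_mem ha.1, ha.2.inv⟩

/-- A closed halfplane, i.e. a closed side of a geodesic line. The geodesic lines of the upper
half-plane are the loci `a|z|² + b Re z + c = 0` with `b² - 4ac > 0`: the vertical lines (`a = 0`)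
and the half-circles centred on the real axis (`a ≠ 0`). -/
def IsHalfplane (H : Set ℍ) : Prop :=
  ∃ a b c : ℝ, 0 < b ^ 2 - 4 * a * c ∧
    H = {z : ℍ | 0 ≤ a * Complex.normSq (z : ℂ) + b * z.re + c}

end HypTiling

/-! The functions `(a|z|² + b Re z + c) / Im z` form a three-dimensional Lorentzian space with
quadratic form `b² - 4ac`. Vectors of negative norm that are positive somewhere are multiples of `z
↦ cosh (dist z p)` and stand for points `p`; null ones stand for boundary points; a vector `n` of
positive norm cuts out the halfplane `n ≥ 0`. Isometries act linearly by pullback and preserve the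
form.

Vertex transitivity and finite degree leave only finitely many tiles up to `Γ`, so tiles have
bounded diameter and inradius bounded below. Hence vertex orbits are cobounded, also under the
orientation preserving subgroup, whose index is at most two, and discrete, by packing inscribed
balls (`IsTiling.exists_cobounded_discrete`).

A cobounded discrete orbit rules out a fixed boundary point (`not_forall_pullback_eq_smul`), so the
orbit of any boundary point enters every open arc (`exists_discForm_pullback_pos`). By
coboundedness, some `γ k x` lie ever deeper in the halfplane of `n₂`. Seen from `x`, the complements
of the pulled back halfplanes shrink, along a subsequence, to a boundary point `N`. Moving `N` by
some `g` into the arc where `n₁` is negative puts such a complement inside the complement of the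
halfplane of `n₁`; taking complements gives the inclusion (`exists_forall_quadFun_nonneg`). -/

namespace HypTiling

/-! ### The Lorentzian space of quadratic functions -/

/-- The function `(a|z|² + b Re z + c) / Im z` attached to a coefficient vector `(a, b, c)`. -/
noncomputable def quadFun (v : ℝ × ℝ × ℝ) (z : ℍ) : ℝ :=
  (v.1 * (z.re ^ 2 + z.im ^ 2) + v.2.1 * z.re + v.2.2) / z.im

/-- The polarization of the discriminant `b² - 4ac`. -/
def discForm (v w : ℝ × ℝ × ℝ) : ℝ := v.2.1 * w.2.1 - 2 * v.1 * w.2.2 - 2 * w.1 * v.2.2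

theorem discForm_comm (v w : ℝ × ℝ × ℝ) : discForm v w = discForm w v := by
  simp only [discForm]; ring

theorem discForm_add_left (u v w : ℝ × ℝ × ℝ) :
    discForm (u + v) w = discForm u w + discForm v w := by
  simp only [discForm, Prod.fst_add, Prod.snd_add]; ring

theorem discForm_smul_left (c : ℝ) (v w : ℝ × ℝ × ℝ) :
    discForm (c • v) w = c * discForm v w := by
  simp only [discForm, Prod.smul_fst, Prod.smul_snd, smul_eq_mul]; ring

theorem discForm_add_right (u v w : ℝ × ℝ × ℝ) :
    discForm w (u + v) = discForm w u + discForm w v := by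
  simp only [discForm, Prod.fst_add, Prod.snd_add]; ring

theorem discForm_smul_right (c : ℝ) (v w : ℝ × ℝ × ℝ) :
    discForm w (c • v) = c * discForm w v := by
  simp only [discForm, Prod.smul_fst, Prod.smul_snd, smul_eq_mul]; ring

theorem quadFun_add (u v : ℝ × ℝ × ℝ) (z : ℍ) :
    quadFun (u + v) z = quadFun u z + quadFun v z := by
  simp only [quadFun, Prod.fst_add, Prod.snd_add]; ring

theorem quadFun_smul (c : ℝ) (v : ℝ × ℝ × ℝ) (z : ℍ) :
    quadFun (c • v) z = c * quadFun v z := by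
  simp only [quadFun, Prod.smul_fst, Prod.smul_snd, smul_eq_mul]; ring

/-- The coefficient vector of `z ↦ cosh (dist z w)`. -/
noncomputable def coshVec (w : ℍ) : ℝ × ℝ × ℝ :=
  (1 / (2 * w.im), -w.re / w.im, (w.re ^ 2 + w.im ^ 2) / (2 * w.im))

theorem quadFun_coshVec (z w : ℍ) : quadFun (coshVec w) z = Real.cosh (dist z w) := by
  have hz := z.im_ne_zero
  have hw := w.im_ne_zero
  rw [cosh_dist']
  simp only [quadFun, coshVec]
  field_simp
  ring

/-- A reproducing property: evaluation at a point is pairing with a vector, so signs of functions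
become signs of Lorentzian products. -/
theorem discForm_coshVec (w : ℍ) (v : ℝ × ℝ × ℝ) : discForm (coshVec w) v = -quadFun v w := by
  have hw := w.im_ne_zero
  simp only [discForm, quadFun, coshVec]
  field_simp
  ring

theorem discForm_coshVec_coshVec (w w' : ℍ) :
    discForm (coshVec w) (coshVec w') = -Real.cosh (dist w w') := by
  rw [discForm_coshVec, quadFun_coshVec]

/-- Three points of the plane whose `coshVec`s form a basis. -/
def basePoint : Fin 3 → ℍ := ![⟨⟨0, 1⟩, one_pos⟩, ⟨⟨0, 2⟩, two_pos⟩, ⟨⟨1, 1⟩, one_pos⟩]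

/-- The coordinates in the basis given by `basePoint`. -/
noncomputable def baseCoord : (ℝ × ℝ × ℝ) →ₗ[ℝ] (Fin 3 → ℝ) where
  toFun v := ![(8 * v.1 - 2 * v.2.2 + 2 * v.2.1) / 3, (4 * v.2.2 - 4 * v.1) / 3 + 2 / 3 * v.2.1,
    -v.2.1]
  map_add' u v := by
    ext i; fin_cases i <;> simp <;> ring
  map_smul' c v := by
    ext i; fin_cases i <;> simp <;> ring

theorem sum_baseCoord (v : ℝ × ℝ × ℝ) :
    ∑ i, baseCoord v i • coshVec (basePoint i) = v := by
  obtain ⟨a, b, c⟩ := v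
  simp only [Fin.sum_univ_three]
  ext <;> simp [baseCoord, basePoint, coshVec] <;> ring

/-- The linear action of isometries on coefficient vectors by pullback of functions. -/
noncomputable def pullback (g : ℍ ≃ᵢ ℍ) : (ℝ × ℝ × ℝ) →ₗ[ℝ] (ℝ × ℝ × ℝ) :=
  ∑ i, ((LinearMap.proj i).comp baseCoord).smulRight (coshVec (g.symm (basePoint i)))

theorem pullback_apply (g : ℍ ≃ᵢ ℍ) (v : ℝ × ℝ × ℝ) :
    pullback g v = ∑ i, baseCoord v i • coshVec (g.symm (basePoint i)) := by
  simp [pullback]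

theorem dist_symm_right (g : ℍ ≃ᵢ ℍ) (z w : ℍ) : dist z (g.symm w) = dist (g z) w := by
  rw [← g.dist_eq, g.apply_symm_apply]

/-- Composing `cosh (dist · w)` with `g` gives `cosh (dist · (g⁻¹ w))`, and such functions span.
Linearity thus comes from distances alone, without classifying the isometries. -/
theorem quadFun_pullback (g : ℍ ≃ᵢ ℍ) (v : ℝ × ℝ × ℝ) (z : ℍ) :
    quadFun (pullback g v) z = quadFun v (g z) := by
  conv_rhs => rw [← sum_baseCoord v]
  rw [pullback_apply]
  simp only [Fin.sum_univ_three, quadFun_add, quadFun_smul, quadFun_coshVec, dist_symm_right]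

/-- On the spanning vectors the form is `-cosh` of a distance, which `g` preserves. -/
theorem discForm_pullback (g : ℍ ≃ᵢ ℍ) (v w : ℝ × ℝ × ℝ) :
    discForm (pullback g v) (pullback g w) = discForm v w := by
  conv_rhs => rw [← sum_baseCoord v, ← sum_baseCoord w]
  rw [pullback_apply, pullback_apply]
  simp only [Fin.sum_univ_three, discForm_add_left, discForm_smul_left, discForm_add_right,
    discForm_smul_right, discForm_coshVec_coshVec, g.symm.dist_eq]

theorem eq_of_quadFun_eq {v w : ℝ × ℝ × ℝ} (h : ∀ z, quadFun v z = quadFun w z) : v = w := by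
  obtain ⟨a, b, c⟩ := v
  obtain ⟨a', b', c'⟩ := w
  have h0 := h (basePoint 0)
  have h1 := h (basePoint 1)
  have h2 := h (basePoint 2)
  simp [quadFun, basePoint] at h0 h1 h2
  ext
  · simp only; linarith
  · simp only; linarith
  · simp only; linarith

theorem pullback_mul (g h : ℍ ≃ᵢ ℍ) (v : ℝ × ℝ × ℝ) :
    pullback (g * h) v = pullback h (pullback g v) :=
  eq_of_quadFun_eq fun z => by simp only [quadFun_pullback]; rfl

theorem pullback_coshVec (g : ℍ ≃ᵢ ℍ) (w : ℍ) : pullback g (coshVec w) = coshVec (g⁻¹ w) :=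
  eq_of_quadFun_eq fun z => by
    rw [quadFun_pullback, quadFun_coshVec, quadFun_coshVec, ← dist_symm_right]; rfl

/-- Completing the square, `4a` times the numerator is a sum of squares minus the discriminant; with
`a < 0` the numerator could not be positive. -/
theorem fst_nonneg_of_discForm_nonpos {v : ℝ × ℝ × ℝ} (hv : discForm v v ≤ 0) {p : ℍ}
    (hp : 0 < quadFun v p) : 0 ≤ v.1 := by
  obtain ⟨a, b, c⟩ := v
  simp only [discForm] at hv
  simp only [quadFun] at hp ⊢
  have hp' := (div_pos_iff_of_pos_right p.im_pos).1 hp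
  by_contra ha
  push Not at ha
  nlinarith [sq_nonneg (2 * a * p.re + b), mul_pos_of_neg_of_neg ha ha,
    mul_nonneg (mul_pos_of_neg_of_neg ha ha).le (sq_nonneg p.im)]

/-- A function with nonpositive discriminant that is positive somewhere is nonnegative. -/
theorem quadFun_nonneg {v : ℝ × ℝ × ℝ} (hv : discForm v v ≤ 0) {p : ℍ} (hp : 0 < quadFun v p)
    (z : ℍ) : 0 ≤ quadFun v z := by
  have ha := fst_nonneg_of_discForm_nonpos hv hp
  obtain ⟨a, b, c⟩ := v
  simp only [discForm] at hv
  simp only [quadFun] at hp ha ⊢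
  have hp' := (div_pos_iff_of_pos_right p.im_pos).1 hp
  refine div_nonneg ?_ z.im_pos.le
  rcases ha.eq_or_lt with rfl | ha
  · have hb : b = 0 := by nlinarith
    subst hb
    simpa using (by simpa using hp' : 0 < c).le
  · by_contra hneg
    push Not at hneg
    nlinarith [sq_nonneg (2 * a * z.re + b), mul_nonneg (mul_pos ha ha).le (sq_nonneg z.im)]

/-! ### Smoothness of isometries and orientation -/

/-- `quadFun` as a function on `ℂ`. -/
noncomputable def quadFunC (v : ℝ × ℝ × ℝ) (w : ℂ) : ℝ :=
  (v.1 * (w.re ^ 2 + w.im ^ 2) + v.2.1 * w.re + v.2.2) / w.im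

theorem quadFunC_coe (v : ℝ × ℝ × ℝ) (z : ℍ) : quadFunC v z = quadFun v z := rfl

theorem contDiffAt_quadFunC (v : ℝ × ℝ × ℝ) {w : ℂ} (hw : w.im ≠ 0) :
    ContDiffAt ℝ 1 (quadFunC v) w := by
  have hre : ContDiffAt ℝ 1 (fun w : ℂ => w.re) w := Complex.reCLM.contDiff.contDiffAt
  have him : ContDiffAt ℝ 1 (fun w : ℂ => w.im) w := Complex.imCLM.contDiff.contDiffAt
  unfold quadFunC
  fun_prop (disch := assumption)

/-- `Re g / Im g` and `1 / Im g` are pullbacks of quadratic functions, so `g` is rational in the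
real coordinates. -/
theorem contDiffAt_inCoord (g : ℍ ≃ᵢ ℍ) (z : ℍ) : ContDiffAt ℝ 1 (inCoord g) (z : ℂ) := by
  have key : inCoord g =ᶠ[nhds (z : ℂ)] fun w =>
      ((quadFunC (pullback g (0, 1, 0)) w / quadFunC (pullback g (0, 0, 1)) w : ℝ) : ℂ) +
        ((1 / quadFunC (pullback g (0, 0, 1)) w : ℝ) : ℂ) * Complex.I := by
    filter_upwards [isOpen_upperHalfPlaneSet.mem_nhds z.im_pos] with w hw
    lift w to ℍ using hw
    rw [inCoord_coe]
    have h1 : quadFunC (pullback g (0, 1, 0)) w = (g w).re / (g w).im := by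
      rw [quadFunC_coe, quadFun_pullback]
      simp [quadFun]
    have h2 : quadFunC (pullback g (0, 0, 1)) w = 1 / (g w).im := by
      rw [quadFunC_coe, quadFun_pullback]
      simp [quadFun]
    have := (g w).im_ne_zero
    rw [h1, h2]
    apply Complex.ext
    · simp; field_simp
    · simp
  refine ContDiffAt.congr_of_eventuallyEq ?_ key
  have hz : (z : ℂ).im ≠ 0 := z.im_ne_zero
  have h1 := contDiffAt_quadFunC (pullback g (0, 1, 0)) hz
  have h2 := contDiffAt_quadFunC (pullback g (0, 0, 1)) hz
  have hne : quadFunC (pullback g (0, 0, 1)) z ≠ 0 := by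
    rw [quadFunC_coe, quadFun_pullback]
    simpa [quadFun] using (g z).im_ne_zero
  have e1 := Complex.ofRealCLM.contDiff.contDiffAt.comp (z : ℂ) (h1.div h2 hne)
  have e2 := Complex.ofRealCLM.contDiff.contDiffAt.comp (z : ℂ)
    ((contDiffAt_const (c := (1 : ℝ))).div h2 hne)
  exact e1.add (e2.mul contDiffAt_const)

theorem det_fderiv_inCoord_mul (g h : ℍ ≃ᵢ ℍ) (z : ℍ) :
    (fderiv ℝ (inCoord (g * h : ℍ ≃ᵢ ℍ)) (z : ℂ)).det =
      (fderiv ℝ (inCoord g) (h z : ℂ)).det * (fderiv ℝ (inCoord h) (z : ℂ)).det := by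
  change (fderiv ℝ (inCoord (g ∘ h)) (z : ℂ)).det = _
  have e : inCoord h (z : ℂ) = ((h z : ℍ) : ℂ) := inCoord_coe h z
  rw [inCoord_comp, fderiv_comp (z : ℂ)
    (e ▸ (contDiffAt_inCoord g (h z)).differentiableAt one_ne_zero)
    ((contDiffAt_inCoord h z).differentiableAt one_ne_zero), e, det_comp_clm]

theorem det_fderiv_inCoord_ne_zero (g : ℍ ≃ᵢ ℍ) (z : ℍ) :
    (fderiv ℝ (inCoord g) (z : ℂ)).det ≠ 0 := by
  have h := det_fderiv_inCoord_mul g⁻¹ g z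
  rw [inv_mul_cancel] at h
  intro h0
  rw [h0, mul_zero] at h
  exact (OrientationPreserving.one z).ne' h

theorem continuous_det_fderiv_inCoord (g : ℍ ≃ᵢ ℍ) :
    Continuous fun z : ℍ => (fderiv ℝ (inCoord g) (z : ℂ)).det := by
  refine ContinuousLinearMap.continuous_det.comp (continuous_iff_continuousAt.2 fun z => ?_)
  exact ((contDiffAt_inCoord g z).continuousAt_fderiv one_ne_zero).comp
    continuous_coe.continuousAt

/-- Every isometry preserves or reverses the orientation. -/
theorem orientationPreserving_or_forall_det_neg (g : ℍ ≃ᵢ ℍ) :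
    OrientationPreserving g ∨ ∀ z : ℍ, (fderiv ℝ (inCoord g) (z : ℂ)).det < 0 := by
  by_contra! hcon
  obtain ⟨h1, w, hw⟩ := hcon
  obtain ⟨z, hz⟩ := not_forall.1 h1
  obtain ⟨u, hu⟩ := mem_range_of_exists_le_of_exists_ge (continuous_det_fderiv_inCoord g)
    ⟨z, not_lt.1 hz⟩ ⟨w, hw⟩
  exact det_fderiv_inCoord_ne_zero g u hu

/-- The orientation preserving isometries in a group form a subgroup of index at most two. -/
theorem exists_mul_mem_orientationPreservingSubgroup (Γ : Subgroup (ℍ ≃ᵢ ℍ)) :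
    ∃ s : ℍ ≃ᵢ ℍ, ∀ g ∈ Γ, g ∈ orientationPreservingSubgroup Γ ∨
      g * s ∈ orientationPreservingSubgroup Γ := by
  by_cases h : ∃ s ∈ Γ, ¬ OrientationPreserving s
  · obtain ⟨s, hs, hs'⟩ := h
    refine ⟨s, fun g hg => ?_⟩
    rcases orientationPreserving_or_forall_det_neg g with hg' | hg'
    · exact Or.inl ⟨hg, hg'⟩
    · refine Or.inr ⟨Γ.mul_mem hg hs, fun z => ?_⟩
      rw [det_fderiv_inCoord_mul]
      exact mul_pos_of_neg_of_neg (hg' _)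
        ((orientationPreserving_or_forall_det_neg s).resolve_left hs' z)
  · push Not at h
    exact ⟨1, fun g hg => Or.inl ⟨hg, h g hg⟩⟩

/-! ### Cobounded and discrete orbits -/

/-- The orbit of `x` under `G` is coarsely dense in the hyperbolic plane. -/
def CoboundedOrbit (G : Subgroup (ℍ ≃ᵢ ℍ)) (x : ℍ) : Prop :=
  ∃ R : ℝ, ∀ z, ∃ g ∈ G, dist (g x) z ≤ R

/-- Only finitely many points of the orbit of `x` under `G` lie in any ball around `x`. -/
def DiscreteOrbit (G : Subgroup (ℍ ≃ᵢ ℍ)) (x : ℍ) : Prop :=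
  ∀ r : ℝ, {y | (∃ g ∈ G, g x = y) ∧ dist y x ≤ r}.Finite

theorem CoboundedOrbit.of_point {G : Subgroup (ℍ ≃ᵢ ℍ)} {x : ℍ} (h : CoboundedOrbit G x) (y : ℍ) :
    CoboundedOrbit G y := by
  obtain ⟨R, hR⟩ := h
  refine ⟨dist y x + R, fun z => ?_⟩
  obtain ⟨g, hg, hgz⟩ := hR z
  refine ⟨g, hg, (dist_triangle _ (g x) _).trans ?_⟩
  rw [g.dist_eq]
  gcongr

/-- A cobounded orbit comes arbitrarily close to any boundary point `s`, so any `quadFun` whose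
numerator is negative at `s` is unbounded below on the orbit. -/
theorem CoboundedOrbit.exists_quadFun_lt {G : Subgroup (ℍ ≃ᵢ ℍ)} {x : ℍ}
    (h : CoboundedOrbit G x) {v : ℝ × ℝ × ℝ} {s : ℝ}
    (hs : v.1 * s ^ 2 + v.2.1 * s + v.2.2 < 0) (M : ℝ) :
    ∃ g ∈ G, quadFun v (g x) < -M := by
  obtain ⟨R, hR⟩ := h
  set P : ℂ → ℝ := fun w => v.1 * (w.re ^ 2 + w.im ^ 2) + v.2.1 * w.re + v.2.2 with hP
  have hPc : Continuous P := by
    have h1 := Complex.continuous_re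
    have h2 := Complex.continuous_im
    fun_prop
  set δ : ℝ := -(v.1 * s ^ 2 + v.2.1 * s + v.2.2) / 2 with hδ
  have hδ0 : 0 < δ := by rw [hδ]; linarith
  have hPs : P (s : ℂ) < -δ := by simp [hP, hδ]; linarith
  obtain ⟨η, hη, hball⟩ := Metric.eventually_nhds_iff.1
    (hPc.continuousAt.eventually (gt_mem_nhds hPs))
  -- Within Euclidean distance `τ` of `s` the numerator stays below `-δ`; at height at most `τ` the
  -- quotient then drops below `-M`.
  set τ := min (η / 2) (δ / (|M| + 1)) with hτ
  have hM : 0 < |M| + 1 := by positivity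
  have hτ0 : 0 < τ := lt_min (by positivity) (by positivity)
  set ε := τ / Real.exp R with hε
  have hε0 : 0 < ε := by positivity
  have hεR : ε * Real.exp R = τ := by rw [hε]; field_simp
  -- The hyperbolic `R`-ball around this point has height at most `ε * exp R = τ` and lies within
  -- `τ` of `s`.
  let z : ℍ := ⟨⟨s, ε⟩, hε0⟩
  obtain ⟨g, hg, hgz⟩ := hR z
  refine ⟨g, hg, ?_⟩
  set w := g x
  have hexp : Real.exp (dist w z) ≤ Real.exp R := Real.exp_le_exp.2 hgz
  have hzim : z.im = ε := rfl
  have him : w.im ≤ τ := by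
    rw [← hεR]
    refine (im_le_im_mul_exp_dist w z).trans ?_
    rw [hzim]
    gcongr
  have hd : dist (w : ℂ) (s : ℂ) ≤ τ := by
    have h1 := dist_coe_le w z
    have h2 : dist (z : ℂ) (s : ℂ) = ε := by
      have h3 : (z : ℂ) - (s : ℂ) = ε * Complex.I := by
        apply Complex.ext <;> simp [z]
      rw [dist_eq_norm, h3]
      simp [abs_of_pos hε0]
    have h3 : ε * (Real.exp (dist w z) - 1) ≤ ε * (Real.exp R - 1) := by gcongr
    have h4 := dist_triangle (w : ℂ) z s
    rw [hzim] at h1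
    nlinarith
  have hPw : P w < -δ := hball (lt_of_le_of_lt hd (lt_of_le_of_lt (min_le_left _ _) (by linarith)))
  have hPw' : quadFun v w = P w / w.im := rfl
  rw [hPw', div_lt_iff₀ w.im_pos]
  have h5 : τ * (|M| + 1) ≤ δ := (le_div_iff₀ hM).1 (min_le_right _ _)
  have h6 : w.im * (|M| + 1) ≤ δ := le_trans (by gcongr) h5
  have h7 := mul_le_mul_of_nonneg_left (le_abs_self M) w.im_pos.le
  have := w.im_pos
  nlinarith

theorem exists_neg_of_discForm_pos {v : ℝ × ℝ × ℝ} (hv : 0 < discForm v v) :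
    ∃ s : ℝ, v.1 * s ^ 2 + v.2.1 * s + v.2.2 < 0 := by
  by_contra! h
  have := discrim_le_zero (a := v.1) (b := v.2.1) (c := v.2.2) fun x => by
    have := h x
    rwa [pow_two] at this
  simp only [discrim, discForm] at this hv
  linarith

/-! ### No fixed boundary point -/

/-- `g` acts on `ℍ` by `x ↦ α x + μ`, `y ↦ |α| y`. -/
def ActsAffinely (g : ℍ ≃ᵢ ℍ) (α μ : ℝ) : Prop :=
  ∀ z, (g z).re = α * z.re + μ ∧ (g z).im = |α| * z.im

theorem ActsAffinely.mul {g h : ℍ ≃ᵢ ℍ} {α μ α' μ' : ℝ} (hg : ActsAffinely g α μ)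
    (hh : ActsAffinely h α' μ') : ActsAffinely (g * h) (α * α') (α * μ' + μ) := by
  intro z
  rw [IsometryEquiv.mul_apply, (hg _).1, (hg _).2, (hh _).1, (hh _).2, abs_mul]
  exact ⟨by ring, by ring⟩

theorem ActsAffinely.ne_zero {g : ℍ ≃ᵢ ℍ} {α μ : ℝ} (hg : ActsAffinely g α μ) : α ≠ 0 := by
  rintro rfl
  have := (hg I).2
  simp only [abs_zero, zero_mul] at this
  exact (g I).im_ne_zero this

/-- Two affine maps with the same linear part differ by a translation. -/
theorem ActsAffinely.mul_inv {g h : ℍ ≃ᵢ ℍ} {α μ μ' : ℝ} (hg : ActsAffinely g α μ)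
    (hh : ActsAffinely h α μ') : ActsAffinely (g * h⁻¹) 1 (μ - μ') := by
  intro z
  have h1 := hh (h⁻¹ z)
  rw [IsometryEquiv.apply_inv_self] at h1
  rw [IsometryEquiv.mul_apply, (hg _).1, (hg _).2, h1.1, h1.2]
  exact ⟨by ring, by simp⟩

/-- The distance formula forces differences of real parts to scale by `l` up to sign; comparing with
the two points `I` and `1 + I` fixes one sign for all points. -/
theorem exists_actsAffinely {g : ℍ ≃ᵢ ℍ} {l : ℝ} (h : ∀ z, (g z).im = l * z.im) :
    ∃ α μ, ActsAffinely g α μ := by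
  have hl : 0 < l := by
    have := h I
    rw [I_im, mul_one] at this
    rw [← this]
    exact (g I).im_pos
  have key : ∀ z w, ((g z).re - (g w).re) ^ 2 = l ^ 2 * (z.re - w.re) ^ 2 := by
    intro z w
    have h1 : Real.cosh (dist (g z) (g w)) = Real.cosh (dist z w) := by rw [g.dist_eq]
    have hz := z.im_ne_zero
    have hw := w.im_ne_zero
    rw [cosh_dist', cosh_dist', h z, h w] at h1
    have hl' := hl.ne'
    field_simp at h1
    linarith
  set p : ℍ := ⟨⟨1, 1⟩, one_pos⟩
  have hp : p.re = 1 := rfl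
  set α := (g p).re - (g I).re with hα
  have hα2 : α ^ 2 = l ^ 2 := by rw [hα, key, hp, I_re]; ring
  have hα0 : α ≠ 0 := by
    intro h0
    rw [h0] at hα2
    have := pow_pos hl 2
    simp at hα2
    linarith
  refine ⟨α, (g I).re, fun z => ⟨?_, ?_⟩⟩
  · have h1 := key z I
    have h2 := key z p
    rw [I_re] at h1
    rw [hp] at h2
    have h3 : (g z).re - (g p).re = ((g z).re - (g I).re) - α := by rw [hα]; ring
    rw [h3] at h2
    have h4 : α * ((g z).re - (g I).re) = α * (α * z.re) := by
      linear_combination (1 / 2) * (h1 - h2) + (1 / 2 - z.re) * hα2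
    linarith [mul_left_cancel₀ hα0 h4]
  · rw [h z, (sq_eq_sq_iff_abs_eq_abs _ _).1 hα2, abs_of_pos hl]

/-- A group with a cobounded discrete orbit does not fix the boundary point `∞`. -/
theorem not_forall_im_eq_mul {G : Subgroup (ℍ ≃ᵢ ℍ)} {x : ℍ} (hc : CoboundedOrbit G x)
    (hd : DiscreteOrbit G x) : ¬ ∀ g ∈ G, ∃ l : ℝ, ∀ z, (g z).im = l * z.im := by
  intro hfix
  have haff : ∀ g ∈ G, ∃ α μ, ActsAffinely g α μ := fun g hg =>
    (hfix g hg).elim fun l hl => exists_actsAffinely hl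
  have hx := x.im_pos
  -- Here the function is `-1 / Im`, so `g` lowers the height of `x` and is a contraction.
  obtain ⟨g, hg, hgx⟩ := hc.exists_quadFun_lt (v := (0, 0, -1)) (s := 0) (by norm_num)
    (1 / x.im)
  obtain ⟨α, μ, hgα⟩ := haff g hg
  have hα0 := hgα.ne_zero
  have hα1 : |α| < 1 := by
    simp only [quadFun, zero_mul, zero_add, (hgα x).2] at hgx
    rw [neg_div, neg_lt_neg_iff, one_div_lt_one_div hx (by positivity)] at hgx
    exact (mul_lt_iff_lt_one_left hx).1 hgx
  have hα1' : 1 - α ≠ 0 := by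
    have := le_abs_self α
    linarith
  -- The commutator of `g` and `h` is the translation by `β`, and conjugating by powers of `g` gives
  -- translations by `α ^ k * β`. If `β ≠ 0`, these put infinitely many orbit points in one ball.
  have hcomm : ∀ h ∈ G, ∀ α' μ', ActsAffinely h α' μ' →
      (α * μ' + μ) - (α' * μ + μ') = 0 := by
    intro h hh α' μ' hα'
    by_contra hβ
    set β := (α * μ' + μ) - (α' * μ + μ') with hβdef
    have hseq : ∀ k : ℕ, ∃ c ∈ G, ActsAffinely c 1 (α ^ k * β) := by
      intro k
      induction k with
      | zero =>
        refine ⟨(g * h) * (h * g)⁻¹, G.mul_mem (G.mul_mem hg hh)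
          (G.inv_mem (G.mul_mem hh hg)), ?_⟩
        have h2 := hα'.mul hgα
        rw [mul_comm] at h2
        simpa using (hgα.mul hα').mul_inv h2
      | succ k ih =>
        obtain ⟨c, hcG, hcα⟩ := ih
        refine ⟨(g * c) * g⁻¹, G.mul_mem (G.mul_mem hg hcG) (G.inv_mem hg), ?_⟩
        have h1 := hgα.mul hcα
        rw [mul_one] at h1
        convert h1.mul_inv hgα using 1
        ring
    choose c hcG hcα using hseq
    have hinj : Function.Injective fun k => c k x := by
      intro k m hkm
      have h1 : (c k x).re = (c m x).re := congrArg UpperHalfPlane.re hkm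
      rw [(hcα k x).1, (hcα m x).1] at h1
      have h2 : α ^ k = α ^ m := mul_right_cancel₀ hβ (by linarith)
      have h3 : |α| ^ k = |α| ^ m := by rw [← abs_pow, ← abs_pow, h2]
      exact (pow_right_strictAnti₀ (abs_pos.2 hα0) hα1).injective h3
    refine Set.infinite_of_injective_forall_mem hinj (fun k => ?_) (hd (|β| / x.im))
    refine ⟨⟨c k, hcG k, rfl⟩, (dist_le_dist_coe_div_sqrt _ _).trans ?_⟩
    have him : (c k x).im = x.im := by rw [(hcα k x).2]; simp
    have hsub : ((c k x : ℍ) : ℂ) - x = ((α ^ k * β : ℝ) : ℂ) := by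
      apply Complex.ext
      · rw [Complex.sub_re, coe_re, coe_re, (hcα k x).1, Complex.ofReal_re]; ring
      · rw [Complex.sub_im, coe_im, coe_im, him, Complex.ofReal_im]; ring
    rw [him, Real.sqrt_mul_self hx.le, dist_eq_norm, hsub, Complex.norm_real, Real.norm_eq_abs,
      abs_mul, abs_pow]
    gcongr
    exact mul_le_of_le_one_left (abs_nonneg _) (pow_le_one₀ (abs_nonneg _) hα1.le)
  -- The fixed point of `g` on the real axis, hence fixed by all of `G`. Then `|Re z - s| / Im z` is
  -- constant on the orbit, whereas coboundedness makes `(Re z - s) / Im z` unbounded below.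
  set s := μ / (1 - α) with hs
  obtain ⟨h, hh, hhx⟩ := hc.exists_quadFun_lt (v := (0, 1, -s)) (s := s - 1) (by norm_num)
    (|x.re - s| / x.im)
  obtain ⟨α', μ', hα'⟩ := haff h hh
  have h1 := hcomm h hh α' μ' hα'
  have hμ' : μ' = (1 - α') * s := by
    rw [hs]
    field_simp
    linarith
  have hα'0 := abs_pos.2 hα'.ne_zero
  have h2 : quadFun (0, 1, -s) (h x) = α' * (x.re - s) / (|α'| * x.im) := by
    simp only [quadFun, (hα' x).1, (hα' x).2, hμ']
    congr 1
    ring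
  have h3 : |quadFun (0, 1, -s) (h x)| = |x.re - s| / x.im := by
    rw [h2, abs_div, abs_mul, abs_mul, abs_abs, abs_of_pos hx]
    field_simp
  have := neg_abs_le (quadFun (0, 1, -s) (h x))
  linarith

theorem dist_eq_of_cosh_dist_eq {a b c d : ℍ}
    (h : Real.cosh (dist a b) = Real.cosh (dist c d)) : dist a b = dist c d := by
  have h1 := Real.cosh_le_cosh.1 h.le
  have h2 := Real.cosh_le_cosh.1 h.ge
  rw [abs_of_nonneg dist_nonneg, abs_of_nonneg dist_nonneg] at h1 h2
  exact le_antisymm h1 h2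

theorem normSq_sub_pos (s : ℝ) (z : ℍ) : 0 < (z.re - s) ^ 2 + z.im ^ 2 := by
  have := z.im_pos
  positivity

/-- The isometry `z ↦ s - 1 / z`, which takes `∞` to the boundary point `s`. -/
noncomputable def fromInfinity (s : ℝ) : ℍ ≃ᵢ ℍ where
  toFun z := ⟨⟨s - z.re / (z.re ^ 2 + z.im ^ 2), z.im / (z.re ^ 2 + z.im ^ 2)⟩, by
    have := z.im_pos
    change 0 < z.im / (z.re ^ 2 + z.im ^ 2)
    positivity⟩
  invFun z := ⟨⟨-(z.re - s) / ((z.re - s) ^ 2 + z.im ^ 2), z.im / ((z.re - s) ^ 2 + z.im ^ 2)⟩,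
    div_pos z.im_pos (normSq_sub_pos s z)⟩
  left_inv z := by
    have := z.im_pos
    have h0 : z.re ^ 2 + z.im ^ 2 ≠ 0 := by positivity
    apply ext_re_im
    · simp only [mk_re, mk_im]
      field_simp
      ring_nf
    · simp only [mk_re, mk_im]
      field_simp
      ring_nf
  right_inv z := by
    have h0 := (normSq_sub_pos s z).ne'
    apply ext_re_im
    · simp only [mk_re, mk_im]
      field_simp
      ring_nf
    · simp only [mk_re, mk_im]
      field_simp
  isometry_toFun := Isometry.of_dist_eq fun z w => by
    apply dist_eq_of_cosh_dist_eq
    have hz := z.im_pos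
    have hw := w.im_pos
    have h1 : z.re ^ 2 + z.im ^ 2 ≠ 0 := by positivity
    have h2 : w.re ^ 2 + w.im ^ 2 ≠ 0 := by positivity
    rw [cosh_dist', cosh_dist']
    simp only [mk_re, mk_im]
    field_simp
    ring

theorem re_fromInfinity (s : ℝ) (z : ℍ) :
    (fromInfinity s z).re = s - z.re / (z.re ^ 2 + z.im ^ 2) := rfl

theorem im_fromInfinity (s : ℝ) (z : ℍ) :
    (fromInfinity s z).im = z.im / (z.re ^ 2 + z.im ^ 2) := rfl

theorem re_fromInfinity_symm (s : ℝ) (z : ℍ) :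
    ((fromInfinity s).symm z).re = -(z.re - s) / ((z.re - s) ^ 2 + z.im ^ 2) := rfl

/-- Any boundary point can be moved to `∞`. -/
theorem exists_quadFun_eq_div_im {v : ℝ × ℝ × ℝ} (hv : discForm v v = 0) (hv0 : v ≠ 0) :
    ∃ (T : ℍ ≃ᵢ ℍ) (c : ℝ), c ≠ 0 ∧ ∀ z, quadFun v (T z) = c / z.im := by
  obtain ⟨a, b, c⟩ := v
  simp only [discForm] at hv
  by_cases ha : a = 0
  · subst ha
    have hb : b = 0 := by nlinarith
    subst hb
    exact ⟨1, c, by rintro rfl; exact hv0 rfl, fun z => by simp [quadFun]⟩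
  -- The boundary point of `v` is the double root of its numerator on the real axis.
  · refine ⟨fromInfinity (-b / (2 * a)), a, ha, fun z => ?_⟩
    have hz := z.im_pos
    have h1 : z.re ^ 2 + z.im ^ 2 ≠ 0 := by positivity
    have hc : c = b ^ 2 / (4 * a) := by field_simp; linarith
    simp only [quadFun, re_fromInfinity, im_fromInfinity, hc]
    field_simp
    ring

/-- A group with a cobounded discrete orbit does not fix a boundary point. -/
theorem not_forall_pullback_eq_smul {G : Subgroup (ℍ ≃ᵢ ℍ)} {x : ℍ} (hc : CoboundedOrbit G x)
    (hd : DiscreteOrbit G x) {v : ℝ × ℝ × ℝ} (hv : discForm v v = 0) (hv0 : v ≠ 0) :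
    ¬ ∀ g ∈ G, ∃ l : ℝ, pullback g v = l • v := by
  intro hfix
  obtain ⟨T, c, hc0, hT⟩ := exists_quadFun_eq_div_im hv hv0
  have hTT : ∀ z, T (T⁻¹ z) = z := fun z => T.apply_symm_apply z
  have hTT' : ∀ z, T⁻¹ (T z) = z := fun z => T.symm_apply_apply z
  let G' : Subgroup (ℍ ≃ᵢ ℍ) := G.map (MulAut.conj T⁻¹).toMonoidHom
  have hG' : ∀ g, g ∈ G' ↔ ∃ h ∈ G, T⁻¹ * h * T = g := by
    intro g
    simp [G', Subgroup.mem_map]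
  refine not_forall_im_eq_mul (G := G') (x := T⁻¹ x) ?_ ?_ ?_
  · obtain ⟨R, hR⟩ := hc
    refine ⟨R, fun z => ?_⟩
    obtain ⟨g, hg, hgz⟩ := hR (T z)
    refine ⟨T⁻¹ * g * T, (hG' _).2 ⟨g, hg, rfl⟩, ?_⟩
    simp only [IsometryEquiv.mul_apply, hTT]
    rwa [← T.dist_eq, hTT]
  · intro r
    refine ((hd r).image (T⁻¹ : ℍ ≃ᵢ ℍ)).subset ?_
    rintro y ⟨⟨g, hg, rfl⟩, hy⟩
    obtain ⟨h, hh, rfl⟩ := (hG' g).1 hg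
    simp only [IsometryEquiv.mul_apply, hTT] at hy ⊢
    rw [T⁻¹.dist_eq] at hy
    exact ⟨h x, ⟨⟨h, hh, rfl⟩, hy⟩, rfl⟩
  · intro g hg
    obtain ⟨h, hh, rfl⟩ := (hG' g).1 hg
    obtain ⟨l, hl⟩ := hfix h hh
    refine ⟨l⁻¹, fun z => ?_⟩
    have h1 : quadFun v (h (T z)) = l * quadFun v (T z) := by
      rw [← quadFun_pullback, hl, quadFun_smul]
    set w := (T⁻¹ * h * T) z with hw
    have h2 : h (T z) = T w := by
      simp only [hw, IsometryEquiv.mul_apply, hTT]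
    rw [h2, hT, hT] at h1
    have hw0 := w.im_ne_zero
    have hz0 := z.im_ne_zero
    have hl0 : l ≠ 0 := by
      rintro rfl
      simp [hc0, hw0] at h1
    field_simp at h1 ⊢
    exact h1.symm

/-! ### Null vectors and orbits of boundary points -/

theorem continuous_discForm_left (w : ℝ × ℝ × ℝ) : Continuous fun v => discForm v w := by
  unfold discForm; fun_prop

theorem continuous_discForm_self : Continuous fun v => discForm v v := by
  unfold discForm; fun_prop

theorem continuous_quadFun_left (z : ℍ) : Continuous fun v => quadFun v z := by
  unfold quadFun; fun_prop

/-- A quadratic of zero discriminant and suitable sign is a square `(pX + q)²`. Two of these pair to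
`-2 (p q' - p' q)²`, which makes positions of boundary points readable from signs. -/
theorem exists_eq_sq_of_discForm_eq_zero {v : ℝ × ℝ × ℝ} (hv : discForm v v = 0) {x : ℍ}
    (hx : 0 < quadFun v x) : ∃ p q : ℝ, v = (p ^ 2, 2 * p * q, q ^ 2) := by
  have ha := fst_nonneg_of_discForm_nonpos hv.le hx
  obtain ⟨a, b, c⟩ := v
  simp only [discForm] at hv
  simp only at ha
  rcases ha.eq_or_lt with rfl | ha
  · have hb : b = 0 := by nlinarith
    subst hb
    have hc : 0 ≤ c := by
      simp only [quadFun] at hx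
      simpa using ((div_pos_iff_of_pos_right x.im_pos).1 hx).le
    exact ⟨0, √c, by simp [Real.sq_sqrt hc]⟩
  · have hs := Real.sqrt_pos.2 ha
    refine ⟨√a, b / (2 * √a), ?_⟩
    rw [div_pow, mul_pow, Real.sq_sqrt ha.le]
    ext
    · rfl
    · simp only; field_simp
    · simp only; field_simp; linarith

/-- Two boundary points with nonnegative pairing coincide. -/
theorem exists_eq_smul_of_discForm_nonneg {v w : ℝ × ℝ × ℝ} (hv : discForm v v = 0)
    (hw : discForm w w = 0) {x y : ℍ} (hx : 0 < quadFun v x) (hy : 0 < quadFun w y)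
    (h : 0 ≤ discForm v w) : ∃ l : ℝ, w = l • v := by
  obtain ⟨p, q, rfl⟩ := exists_eq_sq_of_discForm_eq_zero hv hx
  obtain ⟨p', q', rfl⟩ := exists_eq_sq_of_discForm_eq_zero hw hy
  have h0 : (p * q' - p' * q) ^ 2 = 0 := by
    simp only [discForm] at h
    exact le_antisymm (by nlinarith) (sq_nonneg _)
  have h1 : p * q' = p' * q := by
    have := pow_eq_zero_iff (two_ne_zero) |>.1 h0
    linarith
  by_cases hp : p = 0
  · subst hp
    by_cases hq : q = 0
    · subst hq
      simp [quadFun] at hx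
    · have hp' : p' = 0 := by simpa [hq] using h1.symm
      subst hp'
      refine ⟨(q' / q) ^ 2, ?_⟩
      ext <;> simp [div_pow, hq]
  · refine ⟨(p' / p) ^ 2, ?_⟩
    have hq' : q' = p' * q / p := by field_simp; linarith
    subst hq'
    ext <;> simp <;> field_simp

/-- The point is the root of `a z² + b z + c` in the upper half-plane. -/
theorem exists_eq_smul_coshVec {v : ℝ × ℝ × ℝ} (hv : discForm v v < 0) {x : ℍ}
    (hx : 0 < quadFun v x) : ∃ (p : ℍ) (c : ℝ), 0 < c ∧ v = c • coshVec p := by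
  have ha := fst_nonneg_of_discForm_nonpos hv.le hx
  obtain ⟨a, b, c⟩ := v
  simp only [discForm] at hv
  simp only at ha
  have ha : 0 < a := by
    rcases ha.eq_or_lt with rfl | ha
    · nlinarith [sq_nonneg b]
    · exact ha
  have hD : 0 < 4 * a * c - b ^ 2 := by nlinarith
  have hs := Real.sqrt_pos.2 hD
  have hs2 := Real.sq_sqrt hD.le
  set s := √(4 * a * c - b ^ 2)
  refine ⟨⟨⟨-b / (2 * a), s / (2 * a)⟩, by positivity⟩, s, hs, ?_⟩
  ext
  · simp [coshVec]; field_simp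
  · simp [coshVec]; field_simp
  · simp [coshVec]; field_simp; linarith

/-- The orbit of a boundary point under a group with a cobounded discrete orbit enters every open
arc of the boundary. -/
theorem exists_discForm_pullback_pos {G : Subgroup (ℍ ≃ᵢ ℍ)} {x : ℍ} (hc : CoboundedOrbit G x)
    (hd : DiscreteOrbit G x) {v n : ℝ × ℝ × ℝ} (hv : discForm v v = 0) (hvx : 0 < quadFun v x)
    (hn : 0 < discForm n n) : ∃ g ∈ G, 0 < discForm (pullback g v) n := by
  by_contra! hcon
  have hv0 : v ≠ 0 := by
    rintro rfl
    simp [quadFun] at hvx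
  have hfix := not_forall_pullback_eq_smul hc hd hv hv0
  push Not at hfix
  obtain ⟨g, hg, hgv⟩ := hfix
  have hgv0 : discForm (pullback g v) (pullback g v) = 0 := by rw [discForm_pullback, hv]
  have hgx : 0 < quadFun (pullback g v) (g⁻¹ x) := by
    rwa [quadFun_pullback, IsometryEquiv.apply_inv_self]
  have hneg : discForm v (pullback g v) < 0 := by
    by_contra hnn
    obtain ⟨l, hl⟩ := exists_eq_smul_of_discForm_nonneg hv hgv0 hvx hgx (not_lt.1 hnn)
    exact hgv l hl
  -- The sum of two distinct boundary vectors is a multiple of some `coshVec p`. All its translates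
  -- would pair nonpositively with `n`, making `n` nonnegative on the orbit of `p`, against
  -- coboundedness.
  have hu : discForm (v + pullback g v) (v + pullback g v) < 0 := by
    rw [discForm_add_left, discForm_add_right, discForm_add_right, hv, hgv0,
      discForm_comm (pullback g v) v]
    linarith
  have hux : 0 < quadFun (v + pullback g v) x := by
    rw [quadFun_add]
    exact add_pos_of_pos_of_nonneg hvx (quadFun_nonneg hgv0.le hgx x)
  obtain ⟨p, c, hc0, hpc⟩ := exists_eq_smul_coshVec hu hux
  obtain ⟨s, hs⟩ := exists_neg_of_discForm_pos hn
  obtain ⟨h, hh, hhp⟩ := (hc.of_point p).exists_quadFun_lt hs 0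
  have h1 := hcon _ (G.inv_mem hh)
  have h2 := hcon _ (G.mul_mem hg (G.inv_mem hh))
  rw [pullback_mul] at h2
  have h3 : discForm (pullback h⁻¹ (v + pullback g v)) n ≤ 0 := by
    rw [map_add, discForm_add_left]
    linarith
  rw [hpc, map_smul, pullback_coshVec, inv_inv, discForm_smul_left, discForm_coshVec] at h3
  nlinarith

/-! ### Moving halfplanes by compactness -/

/-- Eliminating `c` by the normalization at `x`, the bound reads `(b + 2a Re x)² + (2a Im x - 1)² ≤
1 + D`: a disc in a spacelike slice. -/
theorem isBounded_setOf_quadFun_eq_one (x : ℍ) (D : ℝ) :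
    Bornology.IsBounded {v : ℝ × ℝ × ℝ | quadFun v x = 1 ∧ discForm v v ≤ D} := by
  have hy := x.im_pos
  set A := (2 + |D|) / (2 * x.im) with hA
  set B := 1 + |D| + 2 * A * |x.re| with hB
  set C := x.im + A * (x.re ^ 2 + x.im ^ 2) + B * |x.re| with hC
  refine (Metric.isBounded_Icc (-A, -B, -C) (A, B, C)).subset ?_
  rintro ⟨a, b, c⟩ ⟨h1, h2⟩
  simp only [quadFun] at h1
  rw [div_eq_one_iff_eq hy.ne'] at h1
  simp only [discForm] at h2
  have hc : c = x.im - a * (x.re ^ 2 + x.im ^ 2) - b * x.re := by linarith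
  have hD := le_abs_self D
  have key : (b + 2 * a * x.re) ^ 2 + (2 * a * x.im - 1) ^ 2 ≤ 1 + |D| := by
    subst hc; nlinarith
  have hbd : 1 + |D| ≤ (1 + |D|) ^ 2 := by nlinarith [abs_nonneg D]
  have k1 : |2 * a * x.im - 1| ≤ 1 + |D| :=
    abs_le_of_sq_le_sq (by nlinarith [sq_nonneg (b + 2 * a * x.re)]) (by positivity)
  have k2 : |b + 2 * a * x.re| ≤ 1 + |D| :=
    abs_le_of_sq_le_sq (by nlinarith [sq_nonneg (2 * a * x.im - 1)]) (by positivity)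
  have ka : |a| ≤ A := by
    rw [hA, le_div_iff₀ (by positivity)]
    have e : |a| * (2 * x.im) = |(2 * a * x.im - 1) + 1| := by
      rw [sub_add_cancel, abs_mul, abs_mul, abs_of_pos hy, abs_two]; ring
    rw [e]
    refine (abs_add_le _ _).trans ?_
    rw [abs_one]; linarith
  have kb : |b| ≤ B := by
    have e : b = (b + 2 * a * x.re) + -(2 * a * x.re) := by ring
    rw [e]
    refine (abs_add_le _ _).trans ?_
    rw [abs_neg, abs_mul, abs_mul, abs_two, hB]
    gcongr
  have kc : |c| ≤ C := by
    have e : c = (x.im + -(a * (x.re ^ 2 + x.im ^ 2))) + -(b * x.re) := by rw [hc]; ring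
    rw [e]
    refine (abs_add_le _ _).trans ?_
    refine (add_le_add_left (abs_add_le _ _) _).trans ?_
    rw [abs_neg, abs_neg, abs_mul, abs_mul, abs_of_pos hy,
      abs_of_nonneg (by positivity : 0 ≤ x.re ^ 2 + x.im ^ 2), hC]
    gcongr
  rw [abs_le] at ka kb kc
  exact ⟨⟨ka.1, kb.1, kc.1⟩, ⟨ka.2, kb.2, kc.2⟩⟩

/-- If `m` is close to a boundary point at which `n` is negative, then the halfplane of `n` lies
in the halfplane of `m`. -/
theorem quadFun_nonneg_of_discForm_le {m n : ℝ × ℝ × ℝ} {p : ℍ} {c δ : ℝ} (hc : 0 ≤ c)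
    (hmp : c * quadFun n p < quadFun m p) (hmn : δ ≤ discForm m n)
    (hcδ : c * discForm n n ≤ δ) (hm : discForm m m ≤ c * δ) {z : ℍ} (hz : 0 ≤ quadFun n z) :
    0 ≤ quadFun m z := by
  -- The norm of `m - c n` is at most `cδ - 2cδ + cδ = 0`, so `m - c n` has constant sign, which is
  -- nonnegative by its value at `p`.
  have h1 : discForm (m + (-c) • n) (m + (-c) • n) ≤ 0 := by
    simp only [discForm_add_left, discForm_add_right, discForm_smul_left, discForm_smul_right,
      discForm_comm n m]
    nlinarith [mul_le_mul_of_nonneg_left hcδ hc, mul_le_mul_of_nonneg_left hmn hc]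
  have h2 : 0 < quadFun (m + (-c) • n) p := by
    rw [quadFun_add, quadFun_smul]; linarith
  have h3 := quadFun_nonneg h1 h2 z
  rw [quadFun_add, quadFun_smul] at h3
  nlinarith [mul_nonneg hc hz]

open Filter Topology in
/-- A group with a cobounded discrete orbit can move any halfplane into any other. -/
theorem exists_forall_quadFun_nonneg {G : Subgroup (ℍ ≃ᵢ ℍ)} {x : ℍ} (hc : CoboundedOrbit G x)
    (hd : DiscreteOrbit G x) {n₁ n₂ : ℝ × ℝ × ℝ} (h₁ : 0 < discForm n₁ n₁)
    (h₂ : 0 < discForm n₂ n₂) :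
    ∃ γ ∈ G, ∀ z, 0 ≤ quadFun n₁ z → 0 ≤ quadFun n₂ (γ z) := by
  have hdeep : ∀ k : ℕ, ∃ γ ∈ G, (k : ℝ) + 1 < quadFun n₂ (γ x) := by
    intro k
    obtain ⟨s, hs⟩ := exists_neg_of_discForm_pos (v := (-1 : ℝ) • n₂) (by
      rw [discForm_smul_left, discForm_smul_right]; linarith)
    obtain ⟨g, hg, hgx⟩ := hc.exists_quadFun_lt hs (k + 1)
    refine ⟨g, hg, ?_⟩
    rw [quadFun_smul] at hgx
    linarith
  choose γ hγ hγx using hdeep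
  set t : ℕ → ℝ := fun k => quadFun n₂ (γ k x) with ht
  have ht1 : ∀ k : ℕ, (k : ℝ) + 1 < t k := hγx
  have ht0 : ∀ k, 1 < t k := fun k => lt_of_le_of_lt (by simp) (ht1 k)
  -- Dividing by the value at `x` keeps the vectors bounded while their norms tend to zero, so a
  -- limit is a nonzero null vector.
  set m : ℕ → ℝ × ℝ × ℝ := fun k => (t k)⁻¹ • pullback (γ k) n₂ with hm
  have hmx : ∀ k, quadFun (m k) x = 1 := fun k => by
    simp only [hm, quadFun_smul, quadFun_pullback]
    exact inv_mul_cancel₀ (by linarith [ht0 k])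
  have hmd : ∀ k, discForm (m k) (m k) = (t k)⁻¹ * (t k)⁻¹ * discForm n₂ n₂ := fun k => by
    simp only [hm, discForm_smul_left, discForm_smul_right, discForm_pullback]
    ring
  have htinv : Tendsto (fun k => (t k)⁻¹) atTop (𝓝 0) := by
    have htt : Tendsto t atTop atTop := tendsto_atTop_mono (fun k => by linarith [ht1 k])
      (tendsto_natCast_atTop_atTop (R := ℝ))
    exact htt.inv_tendsto_atTop
  have hmd0 : Tendsto (fun k => discForm (m k) (m k)) atTop (𝓝 0) := by
    simp only [hmd]
    simpa using (htinv.mul htinv).mul_const (discForm n₂ n₂)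
  have hmb : ∀ k, m k ∈ {v : ℝ × ℝ × ℝ | quadFun v x = 1 ∧ discForm v v ≤ discForm n₂ n₂} := by
    refine fun k => ⟨hmx k, ?_⟩
    rw [hmd]
    have h0 : (t k)⁻¹ ≤ 1 := inv_le_one_of_one_le₀ (ht0 k).le
    have h1 : 0 ≤ (t k)⁻¹ := inv_nonneg.2 (by linarith [ht0 k])
    exact mul_le_of_le_one_left h₂.le (mul_le_one₀ h0 h1 h0)
  obtain ⟨N, -, φ, hφ, hN⟩ := tendsto_subseq_of_bounded (isBounded_setOf_quadFun_eq_one x _) hmb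
  have hN0 : discForm N N = 0 :=
    tendsto_nhds_unique ((continuous_discForm_self.tendsto N).comp hN)
      (hmd0.comp hφ.tendsto_atTop)
  have hNx : quadFun N x = 1 :=
    tendsto_nhds_unique ((continuous_quadFun_left x).tendsto N |>.comp hN)
      (tendsto_const_nhds.congr fun k => (hmx (φ k)).symm)
  obtain ⟨g, hg, hgN⟩ := exists_discForm_pullback_pos hc hd hN0 (by rw [hNx]; exact one_pos) h₁
  set δ := discForm (pullback g N) n₁ / 2 with hδ
  have hδ0 : 0 < δ := by rw [hδ]; linarith
  set p := g⁻¹ x with hp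
  have hgp : g p = x := IsometryEquiv.apply_inv_self _ _
  -- The first bound gives `c * discForm n₁ n₁ ≤ δ`; the second makes `c * quadFun n₁ p` less than
  -- `1`, the value at `p` of the vector compared with `n₁`.
  set c := min (δ / discForm n₁ n₁) (1 / (2 * (|quadFun n₁ p| + 1))) with hcdef
  have hc0 : 0 < c := lt_min (by positivity) (by positivity)
  have ev1 : ∀ᶠ k in atTop, δ < discForm (pullback g (m (φ k))) n₁ := by
    have h1 : Tendsto (fun k => discForm (pullback g (m (φ k))) n₁) atTop
        (𝓝 (discForm (pullback g N) n₁)) :=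
      (((continuous_discForm_left n₁).comp
        (pullback g).continuous_of_finiteDimensional).tendsto N).comp hN
    exact h1.eventually (lt_mem_nhds (by rw [hδ]; linarith))
  have ev2 : ∀ᶠ k in atTop, discForm (m (φ k)) (m (φ k)) < c * δ :=
    (hmd0.comp hφ.tendsto_atTop).eventually (gt_mem_nhds (by positivity))
  obtain ⟨k, hk1, hk2⟩ := (ev1.and ev2).exists
  refine ⟨γ (φ k) * g, G.mul_mem (hγ _) hg, fun z hz => ?_⟩
  have hfin : 0 ≤ quadFun (pullback g (m (φ k))) z := by
    refine quadFun_nonneg_of_discForm_le (p := p) hc0.le ?_ hk1.le ?_ ?_ hz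
    · rw [quadFun_pullback, hgp, hmx]
      have h1 : c * (2 * (|quadFun n₁ p| + 1)) ≤ 1 :=
        (le_div_iff₀ (by positivity)).1 (min_le_right _ _)
      have h2 := mul_le_mul_of_nonneg_left (le_abs_self (quadFun n₁ p)) hc0.le
      have h3 := mul_nonneg hc0.le (abs_nonneg (quadFun n₁ p))
      nlinarith
    · exact (le_div_iff₀ h₁).1 (min_le_left _ _)
    · rw [discForm_pullback]; exact hk2.le
  rw [quadFun_pullback] at hfin
  simp only [hm, quadFun_smul, quadFun_pullback] at hfin
  exact nonneg_of_mul_nonneg_right hfin (inv_pos.2 (by linarith [ht0 (φ k)]))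

/-! ### Geodesic segments and their two sides -/

/-- Any two points lie on a common vertical line after applying an isometry. -/
theorem exists_isometry_re_eq (x y : ℍ) : ∃ T : ℍ ≃ᵢ ℍ, (T x).re = (T y).re := by
  by_cases h : x.re = y.re
  · exact ⟨1, h⟩
  · have hne : y.re - x.re ≠ 0 := fun h' => h (by linarith)
    -- Centre of the half-circle through `x` and `y`; sending its endpoint `c - r` to infinity makes
    -- it vertical.
    set c := (y.re ^ 2 + y.im ^ 2 - x.re ^ 2 - x.im ^ 2) / (2 * (y.re - x.re)) with hc
    have hx := x.im_pos
    have hpos : 0 < (x.re - c) ^ 2 + x.im ^ 2 := normSq_sub_pos c x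
    set r := √((x.re - c) ^ 2 + x.im ^ 2) with hr
    have hr0 : 0 < r := Real.sqrt_pos.2 hpos
    have hr2 : r ^ 2 = (x.re - c) ^ 2 + x.im ^ 2 := Real.sq_sqrt hpos.le
    have hy2 : r ^ 2 = (y.re - c) ^ 2 + y.im ^ 2 := by
      have : c * (2 * (y.re - x.re)) = y.re ^ 2 + y.im ^ 2 - x.re ^ 2 - x.im ^ 2 := by
        rw [hc]; field_simp
      rw [hr2]; linarith
    have key : ∀ z : ℍ, r ^ 2 = (z.re - c) ^ 2 + z.im ^ 2 →
        ((fromInfinity (c - r)).symm z).re = -1 / (2 * r) := by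
      intro z hz
      have h1 := normSq_sub_pos (c - r) z
      rw [re_fromInfinity_symm, div_eq_div_iff h1.ne' (by positivity)]
      nlinarith
    exact ⟨(fromInfinity (c - r)).symm, by rw [key x hr2, key y hy2]⟩

/-- Horizontal projection to the vertical line strictly shortens the distances to its points, so a
point off the line violates equality in the triangle inequality. -/
theorem re_eq_of_mem_geodSegment {x y z : ℍ} (hxy : x.re = y.re) (hz : z ∈ geodSegment x y) :
    z.re = x.re := by
  by_contra hne
  set z' : ℍ := ⟨⟨x.re, z.im⟩, z.im_pos⟩
  have hlt : ∀ u : ℍ, u.re = x.re → dist z' u < dist z u := by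
    intro u hu
    have h1 : Real.cosh (dist z' u) < Real.cosh (dist z u) := by
      rw [cosh_dist', cosh_dist']
      have h2 : z'.im = z.im := rfl
      have h3 : z'.re = x.re := rfl
      have h4 : 0 < (z.re - x.re) ^ 2 := by
        have : z.re - x.re ≠ 0 := sub_ne_zero.2 hne
        positivity
      have hz := z.im_pos
      have hu' := u.im_pos
      rw [h2, h3, hu, sub_self]
      refine div_lt_div_of_pos_right ?_ (by positivity)
      linarith
    have h5 := Real.cosh_lt_cosh.1 h1
    rwa [abs_of_nonneg dist_nonneg, abs_of_nonneg dist_nonneg] at h5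
  have h1 := hlt x rfl
  have h2 := hlt y hxy.symm
  have h3 := dist_triangle x z' y
  have h4 : dist x z + dist z y = dist x y := hz
  rw [dist_comm x z] at h4
  rw [dist_comm x z'] at h3
  linarith

theorem infinite_geodSegment {x y : ℍ} (hxy : x ≠ y) : (geodSegment x y).Infinite := by
  obtain ⟨T, hT⟩ := exists_isometry_re_eq x y
  have hTi : (geodSegment (T x) (T y)).Infinite := by
    have hne : Real.log (T x).im ≠ Real.log (T y).im := by
      intro h
      exact hxy (T.injective (ext_re_im hT
        (Real.log_injOn_pos (T x).im_pos (T y).im_pos h)))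
    set F : ℝ → ℍ := fun u => ⟨⟨(T x).re, Real.exp u⟩, Real.exp_pos u⟩
    have hF : Isometry F := isometry_vertical_line (T x).re
    have hFx : F (Real.log (T x).im) = T x :=
      ext_re_im rfl (Real.exp_log (T x).im_pos)
    have hFy : F (Real.log (T y).im) = T y :=
      ext_re_im hT (Real.exp_log (T y).im_pos)
    have hinf : (segment ℝ (Real.log (T x).im) (Real.log (T y).im)).Infinite := by
      rw [segment_eq_uIcc]
      exact Set.Icc_infinite (by simpa using hne.symm)
    refine (hinf.image hF.injective.injOn).mono ?_
    rintro _ ⟨u, hu, rfl⟩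
    have h := dist_add_dist_of_mem_segment hu
    rw [← hF.dist_eq, ← hF.dist_eq, ← hF.dist_eq, hFx, hFy] at h
    exact h
  rw [← image_geodSegment] at hTi
  exact Set.Infinite.of_image _ hTi

/-- A function that vanishes on `e` and cuts every ball into two connected halves. -/
structure IsSeparator (e : Set ℍ) (f : ℍ → ℝ) : Prop where
  eq_zero : ∀ z ∈ e, f z = 0
  preconnected_pos : ∀ p r, IsPreconnected (Metric.ball p r ∩ {z | 0 < f z})
  preconnected_neg : ∀ p r, IsPreconnected (Metric.ball p r ∩ {z | f z < 0})
  nonempty_pos : ∀ p r, 0 < r → f p = 0 → (Metric.ball p r ∩ {z | 0 < f z}).Nonempty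
  nonempty_neg : ∀ p r, 0 < r → f p = 0 → (Metric.ball p r ∩ {z | f z < 0}).Nonempty

/-- Hyperbolic balls are Euclidean balls, so the intersection is Euclidean convex. -/
theorem isPreconnected_ball_inter_re (p : ℍ) (r : ℝ) {C : Set ℝ} (hC : Convex ℝ C) :
    IsPreconnected (Metric.ball p r ∩ {z | z.re ∈ C}) := by
  rw [← isEmbedding_coe.isInducing.isPreconnected_image]
  have h : ((↑) : ℍ → ℂ) '' (Metric.ball p r ∩ {z | z.re ∈ C}) =
      ((↑) : ℍ → ℂ) '' Metric.ball p r ∩ Complex.reLm ⁻¹' C := by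
    ext w
    constructor
    · rintro ⟨z, ⟨h1, h2⟩, rfl⟩
      exact ⟨⟨z, h1, rfl⟩, h2⟩
    · rintro ⟨⟨z, h1, rfl⟩, h2⟩
      exact ⟨z, ⟨h1, h2⟩, rfl⟩
  rw [h, image_coe_ball]
  exact ((convex_ball _ _).inter (hC.linear_preimage _)).isPreconnected

theorem exists_mem_ball_re_eq_add (p : ℍ) {r : ℝ} (hr : 0 < r) :
    ∃ ε > 0, ∃ z ∈ Metric.ball p r, ∃ w ∈ Metric.ball p r, z.re = p.re + ε ∧ w.re = p.re - ε := by
  have hd : ∀ t : ℝ, dist (t +ᵥ p) p ≤ |t| / p.im := by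
    intro t
    refine (dist_le_dist_coe_div_sqrt _ _).trans ?_
    rw [vadd_im, Real.sqrt_mul_self p.im_pos.le, dist_eq_norm, coe_vadd, add_sub_cancel_right,
      Complex.norm_real, Real.norm_eq_abs]
  have hp := p.im_pos
  have hε : 0 < r * p.im / 2 := by positivity
  have hlt : r * p.im / 2 / p.im < r := by
    rw [div_lt_iff₀ hp]; linarith [mul_pos hr hp]
  refine ⟨r * p.im / 2, hε, (r * p.im / 2) +ᵥ p, ?_, (-(r * p.im / 2)) +ᵥ p, ?_, ?_, ?_⟩
  · exact lt_of_le_of_lt (hd _) (by rwa [abs_of_pos hε])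
  · exact lt_of_le_of_lt (hd _) (by rwa [abs_neg, abs_of_pos hε])
  · rw [vadd_re, add_comm]
  · rw [vadd_re]; ring

theorem exists_isSeparator (x y : ℍ) : ∃ f, IsSeparator (geodSegment x y) f := by
  obtain ⟨T, hT⟩ := exists_isometry_re_eq x y
  have hpre : ∀ p r (C : Set ℝ), Convex ℝ C →
      IsPreconnected (Metric.ball p r ∩ {z | (T z).re ∈ C}) := by
    intro p r C hC
    have h : Metric.ball p r ∩ {z | (T z).re ∈ C} =
        T.symm '' (Metric.ball (T p) r ∩ {z : ℍ | z.re ∈ C}) := by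
      ext z
      constructor
      · rintro ⟨h1, h2⟩
        exact ⟨T z, ⟨by rwa [Metric.mem_ball, T.dist_eq], h2⟩, T.symm_apply_apply z⟩
      · rintro ⟨w, ⟨h1, h2⟩, rfl⟩
        refine ⟨?_, by simpa using h2⟩
        rwa [Metric.mem_ball, ← T.dist_eq, T.apply_symm_apply]
    rw [h]
    exact (isPreconnected_ball_inter_re _ _ hC).image _ T.symm.continuous.continuousOn
  have hnon : ∀ p r, 0 < r → ∃ ε > 0, ∃ z ∈ Metric.ball p r, ∃ w ∈ Metric.ball p r,
      (T z).re = (T p).re + ε ∧ (T w).re = (T p).re - ε := by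
    intro p r hr
    obtain ⟨ε, hε, z, hz, w, hw, h1, h2⟩ := exists_mem_ball_re_eq_add (T p) hr
    refine ⟨ε, hε, T.symm z, ?_, T.symm w, ?_, by simpa using h1, by simpa using h2⟩
    · rw [Metric.mem_ball, ← T.dist_eq, T.apply_symm_apply]; exact hz
    · rw [Metric.mem_ball, ← T.dist_eq, T.apply_symm_apply]; exact hw
  refine ⟨fun z => (T z).re - (T x).re, ⟨fun z hz => ?_, fun p r => ?_, fun p r => ?_,
    fun p r hr hp => ?_, fun p r hr hp => ?_⟩⟩
  · rw [sub_eq_zero]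
    refine re_eq_of_mem_geodSegment hT ?_
    rw [← image_geodSegment]
    exact ⟨z, hz, rfl⟩
  · simpa using hpre p r _ (convex_Ioi (T x).re)
  · simpa using hpre p r _ (convex_Iio (T x).re)
  · obtain ⟨ε, hε, z, hz, w, hw, h1, h2⟩ := hnon p r hr
    refine ⟨z, hz, ?_⟩
    change 0 < (T z).re - (T x).re
    linarith
  · obtain ⟨ε, hε, z, hz, w, hw, h1, h2⟩ := hnon p r hr
    refine ⟨w, hw, ?_⟩
    change (T w).re - (T x).re < 0
    linarith

theorem left_mem_geodSegment (x y : ℍ) : x ∈ geodSegment x y := by simp [geodSegment]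

theorem isClosed_geodSegment (x y : ℍ) : IsClosed (geodSegment x y) :=
  isClosed_eq (by fun_prop) (by fun_prop)

/-! ### Polygons near an inner point of a side -/

namespace Polygon

theorem isClosed (T : Polygon) : IsClosed T.carrier := T.isCompact.isClosed

theorem side_subset_frontier (T : Polygon) {e : Set ℍ} (he : e ∈ T.sides) :
    e ⊆ frontier T.carrier := by
  obtain ⟨n, v, hn, hv, hV, hS, hF⟩ := T.boundary
  rw [hS] at he
  obtain ⟨i, rfl⟩ := he
  rw [hF]
  exact Set.subset_iUnion (fun i => geodSegment (v i) (v (i + 1))) i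

theorem exists_mem_side (T : Polygon) {x : ℍ} (hx : x ∈ T.vertices) : ∃ e ∈ T.sides, x ∈ e := by
  obtain ⟨n, v, hn, hv, hV, hS, hF⟩ := T.boundary
  rw [hV] at hx
  obtain ⟨i, rfl⟩ := hx
  exact ⟨_, by rw [hS]; exact ⟨i, rfl⟩, left_mem_geodSegment _ _⟩

theorem vertices_subset (T : Polygon) : T.vertices ⊆ T.carrier := fun x hx => by
  obtain ⟨e, he, hxe⟩ := T.exists_mem_side hx
  exact T.isClosed.frontier_subset (T.side_subset_frontier he hxe)

theorem nonempty_vertices (T : Polygon) : T.vertices.Nonempty := by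
  obtain ⟨n, v, hn, hv, hV, hS, hF⟩ := T.boundary
  rw [hV]
  exact Set.range_nonempty v

theorem finite_vertices (T : Polygon) : T.vertices.Finite := by
  obtain ⟨n, v, hn, hv, hV, hS, hF⟩ := T.boundary
  have : NeZero n := ⟨by omega⟩
  rw [hV]
  exact Set.finite_range v

theorem exists_side_eq (T : Polygon) {e : Set ℍ} (he : e ∈ T.sides) :
    ∃ x y, x ≠ y ∧ e = geodSegment x y := by
  obtain ⟨n, v, hn, hv, hV, hS, hF⟩ := T.boundary
  rw [hS] at he
  obtain ⟨i, rfl⟩ := he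
  have : Fact (1 < n) := ⟨by omega⟩
  exact ⟨_, _, hv.injective.ne (by simp), rfl⟩

theorem infinite_side (T : Polygon) {e : Set ℍ} (he : e ∈ T.sides) : e.Infinite := by
  obtain ⟨x, y, hxy, rfl⟩ := T.exists_side_eq he
  exact infinite_geodSegment hxy

/-- Near a point of a side that is not a vertex, the boundary is contained in that side. -/
theorem exists_ball_inter_frontier_subset (T : Polygon) {e : Set ℍ} (he : e ∈ T.sides) {p : ℍ}
    (hp : p ∈ e) (hpV : p ∉ T.vertices) :
    ∃ r > 0, Metric.ball p r ∩ frontier T.carrier ⊆ e := by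
  obtain ⟨n, v, hn, hv, hV, hS, hF⟩ := T.boundary
  have : NeZero n := ⟨by omega⟩
  rw [hS] at he
  obtain ⟨i, rfl⟩ := he
  rw [hV] at hpV
  set K : Set ℍ := ⋃ j ∈ {j | j ≠ i}, geodSegment (v j) (v (j + 1)) with hK
  have hKc : IsClosed K :=
    (Set.toFinite _).isClosed_biUnion fun j _ => isClosed_geodSegment _ _
  have hpK : p ∉ K := by
    intro h
    obtain ⟨j, hj, hpj⟩ := Set.mem_iUnion₂.1 h
    have hj : j ≠ i := hj
    by_cases h1 : j = i + 1
    · subst h1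
      have : p ∈ ({v (i + 1)} : Set ℍ) := by
        rw [← hv.consecutive i]; exact ⟨hp, hpj⟩
      exact hpV ⟨i + 1, this.symm⟩
    · by_cases h2 : i = j + 1
      · subst h2
        have : p ∈ ({v (j + 1)} : Set ℍ) := by
          rw [← hv.consecutive j]; exact ⟨hpj, hp⟩
        exact hpV ⟨j + 1, this.symm⟩
      · exact Set.disjoint_left.1 (hv.nonconsecutive i j hj h1 h2) hp hpj
  obtain ⟨r, hr, hball⟩ := Metric.isOpen_iff.1 hKc.isOpen_compl p hpK
  refine ⟨r, hr, ?_⟩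
  rintro q ⟨hq, hqF⟩
  rw [hF] at hqF
  obtain ⟨j, hj⟩ := Set.mem_iUnion.1 hqF
  by_cases hji : j = i
  · subst hji; exact hj
  · exact absurd (Set.mem_biUnion (show j ∈ {j | j ≠ i} from hji) hj) (hball hq)

/-- A polygon contains one of the two halves of a small ball around an inner point of a side. -/
theorem half_ball_subset_interior (T : Polygon) {e : Set ℍ} (he : e ∈ T.sides) {f : ℍ → ℝ}
    (hf : IsSeparator e f) {p : ℍ} (hp : p ∈ e) {r : ℝ} (hr : 0 < r)
    (hball : Metric.ball p r ∩ frontier T.carrier ⊆ e) :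
    Metric.ball p r ∩ {z | 0 < f z} ⊆ interior T.carrier ∨
      Metric.ball p r ∩ {z | f z < 0} ⊆ interior T.carrier := by
  have hcov : ∀ q ∈ Metric.ball p r, f q ≠ 0 → q ∈ interior T.carrier ∪ T.carrierᶜ := by
    intro q hq hfq
    by_contra h
    rw [Set.mem_union, not_or, Set.notMem_compl_iff] at h
    refine hfq (hf.eq_zero q (hball ⟨hq, ?_⟩))
    rw [T.isClosed.frontier_eq]
    exact ⟨h.2, h.1⟩
  have hdisj : Disjoint (interior T.carrier) T.carrierᶜ :=
    Set.disjoint_compl_right_iff_subset.2 interior_subset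
  have hpos := (hf.preconnected_pos p r).subset_or_subset isOpen_interior T.isClosed.isOpen_compl
    hdisj fun q hq => hcov q hq.1 (ne_of_gt hq.2)
  have hneg := (hf.preconnected_neg p r).subset_or_subset isOpen_interior T.isClosed.isOpen_compl
    hdisj fun q hq => hcov q hq.1 (ne_of_lt hq.2)
  rcases hpos with hpos | hpos
  · exact Or.inl hpos
  rcases hneg with hneg | hneg
  · exact Or.inr hneg
  exfalso
  -- If both halves lay outside, interior points near `p` would lie on the zero set of `f`; but any
  -- ball around such a point meets the positive half.
  have hpT : p ∈ closure (interior T.carrier) := by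
    rw [T.closure_interior]
    exact T.isClosed.frontier_subset (T.side_subset_frontier he hp)
  obtain ⟨q, hqT, hq⟩ := Metric.mem_closure_iff.1 hpT r hr
  have hqb : q ∈ Metric.ball p r := by rwa [Metric.mem_ball, dist_comm]
  have hfq : f q = 0 := by
    rcases lt_trichotomy (f q) 0 with h | h | h
    · exact absurd (interior_subset hqT) (hneg ⟨hqb, h⟩)
    · exact h
    · exact absurd (interior_subset hqT) (hpos ⟨hqb, h⟩)
  obtain ⟨ε, hε, hεs⟩ := Metric.isOpen_iff.1 (isOpen_interior.inter Metric.isOpen_ball) q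
    ⟨hqT, hqb⟩
  obtain ⟨u, hu, hfu⟩ := hf.nonempty_pos q ε hε hfq
  exact hpos ⟨(hεs hu).2, hfu⟩ (interior_subset (hεs hu).1)

theorem nonempty_interior (T : Polygon) : (interior T.carrier).Nonempty := by
  rw [← closure_nonempty_iff, T.closure_interior]
  exact T.nonempty_vertices.mono T.vertices_subset

end Polygon

/-! ### Local finiteness and uniform size of tiles -/

namespace IsTiling

variable {𝒯 : Set Polygon}

theorem eq_of_subset_interior (h : IsTiling 𝒯) {T T' : Polygon} (hT : T ∈ 𝒯) (hT' : T' ∈ 𝒯)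
    {S : Set ℍ} (hS : S.Nonempty) (h1 : S ⊆ interior T.carrier) (h2 : S ⊆ interior T'.carrier) :
    T = T' := by
  by_contra hne
  obtain ⟨z, hz⟩ := hS
  exact Set.disjoint_left.1 (h.disjoint_interior T hT T' hT' hne) (h1 hz) (h2 hz)

/-- No edge is a side of three different tiles. -/
theorem eq_of_common_side (h : IsTiling 𝒯) {T₁ T₂ T₃ : Polygon} (h₁ : T₁ ∈ 𝒯) (h₂ : T₂ ∈ 𝒯)
    (h₃ : T₃ ∈ 𝒯) {e : Set ℍ} (e₁ : e ∈ T₁.sides) (e₂ : e ∈ T₂.sides) (e₃ : e ∈ T₃.sides) :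
    T₁ = T₂ ∨ T₁ = T₃ ∨ T₂ = T₃ := by
  obtain ⟨f, hf⟩ : ∃ f, IsSeparator e f := by
    obtain ⟨x, y, -, rfl⟩ := T₁.exists_side_eq e₁
    exact exists_isSeparator x y
  obtain ⟨p, hpe, hpV⟩ := (T₁.infinite_side e₁).exists_notMem_finite
    ((T₁.finite_vertices.union T₂.finite_vertices).union T₃.finite_vertices)
  simp only [Set.mem_union, not_or] at hpV
  obtain ⟨r₁, hr₁, b₁⟩ := T₁.exists_ball_inter_frontier_subset e₁ hpe hpV.1.1
  obtain ⟨r₂, hr₂, b₂⟩ := T₂.exists_ball_inter_frontier_subset e₂ hpe hpV.1.2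
  obtain ⟨r₃, hr₃, b₃⟩ := T₃.exists_ball_inter_frontier_subset e₃ hpe hpV.2
  set r := min r₁ (min r₂ r₃)
  have hr : 0 < r := lt_min hr₁ (lt_min hr₂ hr₃)
  have hle₁ : r ≤ r₁ := min_le_left _ _
  have hle₂ : r ≤ r₂ := (min_le_right _ _).trans (min_le_left _ _)
  have hle₃ : r ≤ r₃ := (min_le_right _ _).trans (min_le_right _ _)
  have c₁ := T₁.half_ball_subset_interior e₁ hf hpe hr
    ((Set.inter_subset_inter_left _ (Metric.ball_subset_ball hle₁)).trans b₁)
  have c₂ := T₂.half_ball_subset_interior e₂ hf hpe hr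
    ((Set.inter_subset_inter_left _ (Metric.ball_subset_ball hle₂)).trans b₂)
  have c₃ := T₃.half_ball_subset_interior e₃ hf hpe hr
    ((Set.inter_subset_inter_left _ (Metric.ball_subset_ball hle₃)).trans b₃)
  have hpos := hf.nonempty_pos p r hr (hf.eq_zero p hpe)
  have hneg := hf.nonempty_neg p r hr (hf.eq_zero p hpe)
  -- Each of the three tiles occupies one of two half balls, so two of them share a half and their
  -- interiors meet.
  rcases c₁ with c₁ | c₁ <;> rcases c₂ with c₂ | c₂
  · exact Or.inl (h.eq_of_subset_interior h₁ h₂ hpos c₁ c₂)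
  · rcases c₃ with c₃ | c₃
    · exact Or.inr (Or.inl (h.eq_of_subset_interior h₁ h₃ hpos c₁ c₃))
    · exact Or.inr (Or.inr (h.eq_of_subset_interior h₂ h₃ hneg c₂ c₃))
  · rcases c₃ with c₃ | c₃
    · exact Or.inr (Or.inr (h.eq_of_subset_interior h₂ h₃ hpos c₂ c₃))
    · exact Or.inr (Or.inl (h.eq_of_subset_interior h₁ h₃ hneg c₁ c₃))
  · exact Or.inl (h.eq_of_subset_interior h₁ h₂ hneg c₁ c₂)

theorem finite_tiles_of_side (h : IsTiling 𝒯) (e : Set ℍ) : {T ∈ 𝒯 | e ∈ T.sides}.Finite := by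
  classical
  by_contra hinf
  obtain ⟨s, hs, hcard⟩ := Set.Infinite.exists_subset_card_eq hinf 3
  obtain ⟨T₁, T₂, T₃, h12, h13, h23, rfl⟩ := Finset.card_eq_three.1 hcard
  have m₁ := hs (show T₁ ∈ (({T₁, T₂, T₃} : Finset Polygon) : Set Polygon) by simp)
  have m₂ := hs (show T₂ ∈ (({T₁, T₂, T₃} : Finset Polygon) : Set Polygon) by simp)
  have m₃ := hs (show T₃ ∈ (({T₁, T₂, T₃} : Finset Polygon) : Set Polygon) by simp)
  rcases h.eq_of_common_side m₁.1 m₂.1 m₃.1 m₁.2 m₂.2 m₃.2 with h | h | h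
  exacts [h12 h, h13 h, h23 h]

theorem finite_tiles_of_vertex (h : IsTiling 𝒯) {x : ℍ} (hx : x ∈ tilingVertices 𝒯) :
    {T ∈ 𝒯 | x ∈ T.vertices}.Finite := by
  refine ((h.finite_degree x hx).biUnion fun e _ => h.finite_tiles_of_side e).subset ?_
  rintro T ⟨hT, hxT⟩
  obtain ⟨e, he, hxe⟩ := T.exists_mem_side hxT
  exact Set.mem_biUnion (show e ∈ {e ∈ tilingEdges 𝒯 | x ∈ e} from
    ⟨Set.mem_biUnion hT he, hxe⟩) ⟨hT, he⟩

end IsTiling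

/-- The polygon has diameter at most `K` and contains a ball of radius `1 / (K + 1)`. -/
def Polygon.HasSize (T : Polygon) (K : ℕ) : Prop :=
  (∀ z ∈ T.carrier, ∀ w ∈ T.carrier, dist z w ≤ K) ∧
    ∃ c, Metric.ball c (1 / ((K : ℝ) + 1)) ⊆ interior T.carrier

theorem Polygon.HasSize.mono {T : Polygon} {K L : ℕ} (h : T.HasSize K) (hKL : K ≤ L) :
    T.HasSize L := by
  have hKL' : (K : ℝ) ≤ L := by exact_mod_cast hKL
  refine ⟨fun z hz w hw => (h.1 z hz w hw).trans hKL', ?_⟩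
  obtain ⟨c, hc⟩ := h.2
  exact ⟨c, (Metric.ball_subset_ball (by gcongr)).trans hc⟩

theorem Polygon.exists_hasSize (T : Polygon) : ∃ K, T.HasSize K := by
  obtain ⟨D, hD⟩ := Metric.isBounded_iff.1 T.isCompact.isBounded
  obtain ⟨c, hc⟩ := T.nonempty_interior
  obtain ⟨r, hr, hball⟩ := Metric.isOpen_iff.1 isOpen_interior c hc
  obtain ⟨K₁, hK₁⟩ := exists_nat_ge D
  obtain ⟨K₂, hK₂⟩ := exists_nat_one_div_lt hr
  refine ⟨max K₁ K₂, fun z hz w hw => (hD hz hw).trans (hK₁.trans (by simp)), c, ?_⟩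
  refine (Metric.ball_subset_ball (le_trans ?_ hK₂.le)).trans hball
  gcongr
  exact le_max_right _ _

theorem Polygon.HasSize.of_map {T : Polygon} {g : ℍ ≃ᵢ ℍ} {K : ℕ} (h : (T.map g).HasSize K) :
    T.HasSize K := by
  refine ⟨fun z hz w hw => ?_, ?_⟩
  · rw [← g.dist_eq]
    exact h.1 _ ⟨z, hz, rfl⟩ _ ⟨w, hw, rfl⟩
  · obtain ⟨c, hc⟩ := h.2
    refine ⟨g.symm c, fun z hz => ?_⟩
    have h1 : g z ∈ interior (g '' T.carrier) := hc (by
      rwa [Metric.mem_ball, dist_symm_right] at hz)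
    have h2 : interior (g '' T.carrier) = g '' interior T.carrier :=
      (g.toHomeomorph.image_interior T.carrier).symm
    rw [h2] at h1
    exact g.injective.mem_set_image.1 h1

/-- Every tile has a translate with vertex `x`, and only finitely many tiles have that vertex. -/
theorem IsTiling.exists_forall_hasSize {𝒯 : Set Polygon} (h : IsTiling 𝒯)
    {Γ : Subgroup (ℍ ≃ᵢ ℍ)} (hΓ : ActsVertexTransitively Γ 𝒯) {x : ℍ}
    (hx : x ∈ tilingVertices 𝒯) : ∃ K, ∀ T ∈ 𝒯, T.HasSize K := by
  choose K hK using Polygon.exists_hasSize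
  obtain ⟨L, hL⟩ := ((h.finite_tiles_of_vertex hx).image K).bddAbove
  refine ⟨L, fun T hT => ?_⟩
  obtain ⟨y, hy⟩ := T.nonempty_vertices
  obtain ⟨g, hg, rfl⟩ := hΓ.transitive y (Set.mem_biUnion hT hy) x hx
  exact ((hK (T.map g)).mono
    (hL ⟨T.map g, ⟨hΓ.preserves g hg T hT, ⟨y, hy, rfl⟩⟩, rfl⟩)).of_map

theorem finite_of_separated {ι : Type*} {s : Set ι} {c : ι → ℍ} {r ρ : ℝ} (hr : 0 < r) {x : ℍ}
    (hc : ∀ i ∈ s, c i ∈ Metric.closedBall x ρ)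
    (hsep : ∀ i ∈ s, ∀ j ∈ s, dist (c i) (c j) < r → i = j) : s.Finite := by
  obtain ⟨t, htf, hcov⟩ := Metric.totallyBounded_iff.1
    (isCompact_closedBall x ρ).totallyBounded (r / 2) (half_pos hr)
  have hsub : s ⊆ ⋃ y ∈ t, {i ∈ s | c i ∈ Metric.ball y (r / 2)} := by
    intro i hi
    obtain ⟨y, hy, hiy⟩ := Set.mem_iUnion₂.1 (hcov (hc i hi))
    exact Set.mem_biUnion hy ⟨hi, hiy⟩
  refine (htf.biUnion fun y _ => Set.Subsingleton.finite ?_).subset hsub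
  rintro i ⟨hi, hiy⟩ j ⟨hj, hjy⟩
  refine hsep i hi j hj ?_
  have := dist_triangle_right (c i) (c j) y
  rw [Metric.mem_ball] at hiy hjy
  linarith

/-- A packing argument: tiles meeting the ball have inscribed centres in a larger ball, and disjoint
interiors keep these centres at least `1 / (K + 1)` apart. -/
theorem IsTiling.finite_vertices_inter {𝒯 : Set Polygon} (h : IsTiling 𝒯) {K : ℕ}
    (hK : ∀ T ∈ 𝒯, T.HasSize K) (x : ℍ) (ρ : ℝ) :
    (tilingVertices 𝒯 ∩ Metric.closedBall x ρ).Finite := by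
  have hr : (0 : ℝ) < 1 / ((K : ℝ) + 1) := by positivity
  have hcen : ∀ T : Polygon, ∃ c, T ∈ 𝒯 → Metric.ball c (1 / ((K : ℝ) + 1)) ⊆ interior T.carrier :=
    fun T => by
      by_cases hT : T ∈ 𝒯
      · exact (hK T hT).2.imp fun c hc _ => hc
      · exact ⟨x, fun h => absurd h hT⟩
  choose c hc using hcen
  have hfin : {T ∈ 𝒯 | (T.carrier ∩ Metric.closedBall x ρ).Nonempty}.Finite := by
    refine finite_of_separated (c := c) hr (x := x) (ρ := K + ρ) ?_ ?_
    · rintro T ⟨hT, z, hzT, hz⟩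
      have h1 : c T ∈ T.carrier := interior_subset (hc T hT (Metric.mem_ball_self hr))
      exact (dist_triangle _ z _).trans (add_le_add ((hK T hT).1 _ h1 _ hzT) hz)
    · rintro T ⟨hT, -⟩ T' ⟨hT', -⟩ hd
      exact h.eq_of_subset_interior hT hT' (S := {c T}) (Set.singleton_nonempty _)
        (Set.singleton_subset_iff.2 (hc T hT (Metric.mem_ball_self hr)))
        (Set.singleton_subset_iff.2 (hc T' hT' hd))
  refine (hfin.biUnion fun T _ => T.finite_vertices).subset ?_
  rintro y ⟨hy, hyx⟩
  obtain ⟨T, hT, hyT⟩ := Set.mem_iUnion₂.1 hy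
  exact Set.mem_biUnion (show T ∈ {T ∈ 𝒯 | (T.carrier ∩ Metric.closedBall x ρ).Nonempty} from
    ⟨hT, y, T.vertices_subset hyT, hyx⟩) hyT

theorem ActsVertexTransitively.apply_mem {𝒯 : Set Polygon} {Γ : Subgroup (ℍ ≃ᵢ ℍ)}
    (hΓ : ActsVertexTransitively Γ 𝒯) {g : ℍ ≃ᵢ ℍ} (hg : g ∈ Γ) {x : ℍ}
    (hx : x ∈ tilingVertices 𝒯) : g x ∈ tilingVertices 𝒯 := by
  obtain ⟨T, hT, hxT⟩ := Set.mem_iUnion₂.1 hx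
  exact Set.mem_biUnion (hΓ.preserves g hg T hT) ⟨x, hxT, rfl⟩

/-- The orientation preserving subgroup of a vertex transitive group has a cobounded discrete
orbit. -/
theorem IsTiling.exists_cobounded_discrete {𝒯 : Set Polygon} (h : IsTiling 𝒯)
    {Γ : Subgroup (ℍ ≃ᵢ ℍ)} (hΓ : ActsVertexTransitively Γ 𝒯) :
    ∃ x, CoboundedOrbit (orientationPreservingSubgroup Γ) x ∧
      DiscreteOrbit (orientationPreservingSubgroup Γ) x := by
  have hcov : ∀ z : ℍ, ∃ T ∈ 𝒯, z ∈ T.carrier := fun z => by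
    have : z ∈ ⋃ T ∈ 𝒯, T.carrier := by rw [h.covers]; trivial
    simpa using this
  obtain ⟨T₀, hT₀, -⟩ := hcov I
  obtain ⟨x, hx₀⟩ := T₀.nonempty_vertices
  have hx : x ∈ tilingVertices 𝒯 := Set.mem_biUnion hT₀ hx₀
  obtain ⟨K, hK⟩ := h.exists_forall_hasSize hΓ hx
  refine ⟨x, ?_, fun r => ?_⟩
  -- Replacing an orientation reversing `g` by `g * s` moves the orbit point by only `dist (s x) x`,
  -- whatever `g` is.
  · obtain ⟨s, hs⟩ := exists_mul_mem_orientationPreservingSubgroup Γ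
    refine ⟨dist (s x) x + K, fun z => ?_⟩
    obtain ⟨T, hT, hzT⟩ := hcov z
    obtain ⟨y, hy⟩ := T.nonempty_vertices
    obtain ⟨g, hg, rfl⟩ := hΓ.transitive x hx y (Set.mem_biUnion hT hy)
    have hgz : dist (g x) z ≤ K := (hK T hT).1 _ (T.vertices_subset hy) _ hzT
    rcases hs g hg with hg' | hg'
    · exact ⟨g, hg', hgz.trans (le_add_of_nonneg_left dist_nonneg)⟩
    · refine ⟨g * s, hg', (dist_triangle _ (g x) _).trans (add_le_add ?_ hgz)⟩
      rw [IsometryEquiv.mul_apply, g.dist_eq]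
  · refine (h.finite_vertices_inter hK x r).subset ?_
    rintro y ⟨⟨g, hg, rfl⟩, hy⟩
    exact ⟨hΓ.apply_mem hg.1 hx, hy⟩

theorem IsHalfplane.exists_quadFun {H : Set ℍ} (h : IsHalfplane H) :
    ∃ n, 0 < discForm n n ∧ ∀ z, z ∈ H ↔ 0 ≤ quadFun n z := by
  obtain ⟨a, b, c, hd, rfl⟩ := h
  refine ⟨(a, b, c), by simp only [discForm]; linarith, fun z => ?_⟩
  have h1 : Complex.normSq (z : ℂ) = z.re ^ 2 + z.im ^ 2 := by
    rw [Complex.normSq_apply, coe_re, coe_im]; ring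
  have h2 : 0 ≤ quadFun (a, b, c) z ↔ 0 ≤ a * (z.re ^ 2 + z.im ^ 2) + b * z.re + c :=
    ⟨fun h => by simpa using (le_div_iff₀ z.im_pos).1 h, fun h => div_nonneg h z.im_pos.le⟩
  rw [h2, Set.mem_ofPred_eq, h1]

end HypTiling

theorem mainTheorem6 (𝒯 : Set HypTiling.Polygon) (h𝒯 : HypTiling.IsTiling 𝒯)
    (Γ : Subgroup (UpperHalfPlane ≃ᵢ UpperHalfPlane))
    (hΓ : HypTiling.ActsVertexTransitively Γ 𝒯)
    (H₁ H₂ : Set UpperHalfPlane)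
    (hH₁ : HypTiling.IsHalfplane H₁) (hH₂ : HypTiling.IsHalfplane H₂) :
    ∃ γ ∈ HypTiling.orientationPreservingSubgroup Γ, γ '' H₁ ⊆ H₂ := by
  obtain ⟨x, hc, hd⟩ := h𝒯.exists_cobounded_discrete hΓ
  obtain ⟨n₁, h₁, hn₁⟩ := hH₁.exists_quadFun
  obtain ⟨n₂, h₂, hn₂⟩ := hH₂.exists_quadFun
  obtain ⟨γ, hγ, hsub⟩ := HypTiling.exists_forall_quadFun_nonneg hc hd h₁ h₂
  refine ⟨γ, hγ, ?_⟩
  rintro _ ⟨z, hz, rfl⟩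
  exact (hn₂ _).2 (hsub z ((hn₁ z).1 hz))
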